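/- Let $E$ and $F$ be (real) Banach lattices with $F$ Dedekind complete, and let $n\in\mathbb N$. An $n$-homogeneous polynomial $P\colon E\to F$ is a map $P(x)=T_P(x,\dots,x)$ with $T_P\colon E^n\to F$ symmetric and $n$-linear. It is positive if $T_P(x_1,\dots,x_n)\ge 0$ for all $x_1,\dots,x_n\ge 0$, and $P\le Q$ means that $Q-P$ is positive. Let $\mathcal P(^nE;F)$ be the space of continuous $n$-homogeneous polynomials with $\|P\|=\sup_{\|x\|\le 1}\|P(x)\|$, and let $\mathcal P^r(^nE;F)$ be the space of regular polynomials, i.e. differences of two positive $n$-homogeneous polynomials, which is a vector lattice since $F$ is Dedekind complete; $|P|$ denotes the absolute value of $P$ in it, and $\|P\|_r=\inf\{\|Q\| : Q \text{ a positive } n\text{-homogeneous polynomial},\ Q\ge|P|\}$. Let $\mathcal A$ be a linear subspace of $\mathcal P(^nE;F)$ endowed with a complete norm $\|\cdot\|_{\mathcal A}$, and let $\mathcal A^+$ be the set of positive members of $\mathcal A$. Assume: (I) $\|P\|\le\|P\|_{\mathcal A}$ for every $P\in\mathcal A$; (II) $\|P\|_{\mathcal A}\le\|Q\|_{\mathcal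 A}$ for all $P\in\mathcal A$ and $Q\in\mathcal A^+$ such that $|P(x)|\le Q(|x|)$ for every $x\in E$. Then $$\|P\|_{\mathcal A,r}:=\inf\{\|Q\|_{\mathcal A} : Q\in\mathcal A^+,\ Q\ge|P|\}$$ defines a complete norm on $\mathcal A^r:=\operatorname{span}(\mathcal A^+)$ such that $\|P\|_{\mathcal A,r}\ge\|P\|_r$ for every $P\in\mathcal A^r$. If, in addition, $(E,F)$ satisfies the $\mathcal A$-domination property, that is, $P\in\mathcal A$ whenever $P,Q\colon E\to F$ are positive $n$-homogeneous polynomials with $P\le Q$ and $Q\in\mathcal A$, then $(\mathcal A^r,\|\cdot\|_{\mathcal A,r})$, with the order inherited from $\mathcal P^r(^nE;F)$, is a Banach lattice, $\|P\|_{\mathcal A}\le\|P\|_{\mathcal A,r}$ for every $P\in\mathcal A^r$, and $\mathcal A^r$ is an ideal in $\mathcal P^r(^nE;F)$ (i.e. $Q\in\mathcal A^r$ whenever $P\in\mathcal A^r$, $Q\in\mathcal P^r(^nE;F)$ and $|Q|\le|P|$). -/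

import Mathlib

open Filter Topology

noncomputable section

/-- Every nonempty subset that is bounded above has a supremum. -/
def IsDedekindComplete (F : Type*) [PartialOrder F] : Prop :=
  ∀ s : Set F, s.Nonempty → BddAbove s → ∃ a, IsLUB s a

section Abstract

variable {V : Type*} [AddCommGroup V] [Module ℝ V]

/-- `N` is a norm on the real vector space `V`, and `V` is complete for it. -/
structure IsCompleteNorm (N : V → ℝ) : Prop where
  nonneg : ∀ v, 0 ≤ N v
  eq_zero : ∀ v, N v = 0 → v = 0
  smul : ∀ (c : ℝ) (v : V), N (c • v) = |c| * N v
  add_le : ∀ v w, N (v + w) ≤ N v + N w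
  complete : ∀ u : ℕ → V,
    (∀ ε > 0, ∃ K, ∀ i ≥ K, ∀ j ≥ K, N (u i - u j) < ε) →
      ∃ v, Tendsto (fun i => N (u i - v)) atTop (𝓝 0)

/-- `m` is the absolute value `|a| = a ∨ (-a)` of `a` in the ordered vector space `V`. -/
def IsModulus {V : Type*} [AddCommGroup V] [PartialOrder V] (a m : V) : Prop :=
  IsLUB {a, -a} m

variable (V) in
/-- The ordered real vector space `V` is a vector lattice (Riesz space). -/
structure IsVectorLattice [PartialOrder V] : Prop where
  add_le_add : ∀ a b c : V, a ≤ b → a + c ≤ b + c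
  smul_nonneg : ∀ (r : ℝ) (a : V), 0 ≤ r → 0 ≤ a → 0 ≤ r • a
  exists_sup : ∀ a b : V, ∃ c, IsLUB {a, b} c

/-- `V` with the norm `N` is a Banach lattice: a vector lattice with a complete lattice norm. -/
structure IsBanachLattice [PartialOrder V] (N : V → ℝ) : Prop where
  vectorLattice : IsVectorLattice V
  completeNorm : IsCompleteNorm N
  solid : ∀ a b a' b' : V, IsModulus a a' → IsModulus b b' → a' ≤ b' → N a ≤ N b

/-- The subspace `I` of the vector lattice `V` is an (order) ideal:
`|b| ≤ |a|` and `a ∈ I` imply `b ∈ I`. -/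
def IsLatticeIdeal [PartialOrder V] (I : Submodule ℝ V) : Prop :=
  ∀ a b a' b' : V, a ∈ I → IsModulus a a' → IsModulus b b' → b' ≤ a' → b ∈ I

end Abstract

section Polynomials

/-- The multilinear map `T` is symmetric and `P x = T (x, …, x)` for all `x`. By polarization,
`T` is determined by `P`. -/
def IsAssociated {n : ℕ} {E F : Type*} [AddCommGroup E] [Module ℝ E] [AddCommGroup F] [Module ℝ F]
    (T : MultilinearMap ℝ (fun _ : Fin n => E) F) (P : E → F) : Prop :=
  (∀ (σ : Equiv.Perm (Fin n)) (v : Fin n → E), T (fun i => v (σ i)) = T v) ∧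
    ∀ x, P x = T (fun _ => x)

variable (n : ℕ) (E F : Type*)

/-- The vector space of `n`-homogeneous polynomials from `E` to `F`, as functions. -/
def homPolySubmodule [AddCommGroup E] [Module ℝ E] [AddCommGroup F] [Module ℝ F] :
    Submodule ℝ (E → F) where
  carrier := {P | ∃ T : MultilinearMap ℝ (fun _ : Fin n => E) F, IsAssociated T P}
  zero_mem' := ⟨0, by simp [IsAssociated]⟩
  add_mem' := by
    rintro P Q ⟨T, hT, hTP⟩ ⟨S, hS, hSQ⟩
    exact ⟨T + S, fun σ v => by simp [hT σ v, hS σ v], fun x => by simp [hTP x, hSQ x]⟩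
  smul_mem' := by
    rintro c P ⟨T, hT, hTP⟩
    exact ⟨c • T, fun σ v => by simp [hT σ v], fun x => by simp [hTP x]⟩

/-- The type of (not necessarily continuous) `n`-homogeneous polynomials from `E` to `F`. It is not
reducible, so that it does not inherit the pointwise order of functions. -/
def HomPoly [AddCommGroup E] [Module ℝ E] [AddCommGroup F] [Module ℝ F] : Type _ :=
  ↥(homPolySubmodule n E F)

variable {n E F}

namespace HomPoly

section Algebra

variable [AddCommGroup E] [Module ℝ E] [AddCommGroup F] [Module ℝ F]

instance : AddCommGroup (HomPoly n E F) := inferInstanceAs (AddCommGroup (homPolySubmodule n E F))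

instance : Module ℝ (HomPoly n E F) := inferInstanceAs (Module ℝ (homPolySubmodule n E F))

instance : CoeFun (HomPoly n E F) (fun _ => E → F) := ⟨fun P => P.1⟩

theorem add_apply (P Q : HomPoly n E F) (x : E) : (P + Q) x = P x + Q x := rfl

theorem sub_apply (P Q : HomPoly n E F) (x : E) : (P - Q) x = P x - Q x := rfl

theorem neg_apply (P : HomPoly n E F) (x : E) : (-P) x = -P x := rfl

theorem zero_apply (x : E) : (0 : HomPoly n E F) x = 0 := rfl

theorem smul_apply (c : ℝ) (P : HomPoly n E F) (x : E) : (c • P) x = c • P x := rfl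

theorem ext {P Q : HomPoly n E F} (h : ∀ x, P x = Q x) : P = Q := Subtype.ext (funext h)

end Algebra

section Order

variable [AddCommGroup E] [Module ℝ E] [Lattice E]
  [AddCommGroup F] [Module ℝ F] [PartialOrder F]

/-- `P` is positive: its associated symmetric multilinear map takes nonnegative values on
nonnegative arguments. -/
def IsPositive (P : HomPoly n E F) : Prop :=
  ∃ T : MultilinearMap ℝ (fun _ : Fin n => E) F,
    IsAssociated T P ∧ ∀ v : Fin n → E, (∀ i, 0 ≤ v i) → 0 ≤ T v

theorem isPositive_zero : IsPositive (0 : HomPoly n E F) :=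
  ⟨0, ⟨by simp, fun x => by simp [zero_apply]⟩, by simp⟩

theorem IsPositive.add [IsOrderedAddMonoid F] {P Q : HomPoly n E F} (hP : IsPositive P)
    (hQ : IsPositive Q) : IsPositive (P + Q) := by
  obtain ⟨T, ⟨hT, hTP⟩, hT0⟩ := hP
  obtain ⟨S, ⟨hS, hSQ⟩, hS0⟩ := hQ
  refine ⟨T + S, ⟨fun σ v => by simp [hT σ v, hS σ v], fun x => ?_⟩,
    fun v hv => add_nonneg (hT0 v hv) (hS0 v hv)⟩
  rw [add_apply, hTP, hSQ, _root_.add_apply]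

theorem IsPositive.smul [IsOrderedAddMonoid F] [IsOrderedModule ℝ F] {P : HomPoly n E F} {c : ℝ}
    (hc : 0 ≤ c) (hP : IsPositive P) : IsPositive (c • P) := by
  obtain ⟨T, ⟨hT, hTP⟩, hT0⟩ := hP
  refine ⟨c • T, ⟨fun σ v => by simp [hT σ v], fun x => ?_⟩,
    fun v hv => smul_nonneg hc (hT0 v hv)⟩
  rw [smul_apply, hTP, _root_.smul_apply]

theorem IsPositive.eq_zero [IsOrderedAddMonoid E] [IsOrderedAddMonoid F] {P : HomPoly n E F}
    (hP : IsPositive P) (hP' : IsPositive (-P)) : P = 0 := by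
  obtain ⟨T, ⟨-, hTP⟩, hT0⟩ := hP
  obtain ⟨S, ⟨-, hSP⟩, hS0⟩ := hP'
  have key : ∀ u : Fin n → E, (∀ i, 0 ≤ u i) → T u = 0 := by
    intro u hu
    refine le_antisymm ?_ (hT0 u hu)
    set s : E := ∑ i, u i with hs
    have hs0 : 0 ≤ s := Finset.sum_nonneg fun i _ => hu i
    have h1 : T (fun _ => s) ≤ 0 := by
      have h2 := hS0 (fun _ => s) fun _ => hs0
      rw [← hSP s, neg_apply, hTP s] at h2
      exact neg_nonneg.mp h2
    refine le_trans ?_ h1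
    have h3 : (fun _ => s) = u + fun i => s - u i := by
      funext i; simp
    rw [h3, MultilinearMap.map_add_univ]
    have h4 : T u = T (Finset.univ.piecewise u fun i => s - u i) := by simp
    rw [h4]
    refine Finset.single_le_sum
      (f := fun t : Finset (Fin n) => T (t.piecewise u fun i => s - u i)) (fun t _ => ?_)
      (Finset.mem_univ _)
    refine hT0 _ fun i => ?_
    by_cases hi : i ∈ t
    · simpa [hi] using hu i
    · simpa [hi] using Finset.single_le_sum (f := u) (fun j _ => hu j) (Finset.mem_univ i)
  refine ext fun x => ?_
  rw [hTP x, zero_apply]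
  have h5 : (fun _ : Fin n => x) = (fun _ => x⁺) + fun _ => -x⁻ := by
    funext i
    simp [← sub_eq_add_neg]
  rw [h5, MultilinearMap.map_add_univ]
  refine Finset.sum_eq_zero fun t _ => ?_
  have h6 : t.piecewise (fun _ : Fin n => x⁺) (fun _ => -x⁻) =
      fun i => (if i ∈ t then (1 : ℝ) else -1) • (if i ∈ t then x⁺ else x⁻) := by
    funext i
    by_cases hi : i ∈ t <;> simp [hi]
  rw [h6, MultilinearMap.map_smul_univ, key, smul_zero]
  intro i
  by_cases hi : i ∈ t
  · simpa [hi] using posPart_nonneg x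
  · simpa [hi] using negPart_nonneg x

/-- The order of polynomials: `P ≤ Q` means that `Q - P` is positive. -/
instance [IsOrderedAddMonoid E] [IsOrderedAddMonoid F] : PartialOrder (HomPoly n E F) where
  le P Q := IsPositive (Q - P)
  le_refl P := by rw [sub_self]; exact isPositive_zero
  le_trans P Q R h₁ h₂ := by
    rw [← sub_add_sub_cancel R Q P]
    exact IsPositive.add h₂ h₁
  le_antisymm P Q h₁ h₂ := by
    have h := IsPositive.eq_zero h₁ (by simpa using h₂)
    exact (sub_eq_zero.mp h).symm

variable (n E F) in
/-- The space `𝒫ʳ(ⁿE; F)` of regular polynomials: differences of two positive polynomials. -/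
def regular [IsOrderedAddMonoid F] [IsOrderedModule ℝ F] : Submodule ℝ (HomPoly n E F) where
  carrier := {P | ∃ P₁ P₂ : HomPoly n E F, IsPositive P₁ ∧ IsPositive P₂ ∧ P = P₁ - P₂}
  zero_mem' := ⟨0, 0, isPositive_zero, isPositive_zero, by simp⟩
  add_mem' := by
    rintro P Q ⟨P₁, P₂, h₁, h₂, rfl⟩ ⟨Q₁, Q₂, k₁, k₂, rfl⟩
    exact ⟨P₁ + Q₁, P₂ + Q₂, h₁.add k₁, h₂.add k₂, by abel⟩
  smul_mem' := by
    rintro c P ⟨P₁, P₂, h₁, h₂, rfl⟩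
    rcases le_total 0 c with hc | hc
    · exact ⟨c • P₁, c • P₂, h₁.smul hc, h₂.smul hc, by rw [smul_sub]⟩
    · refine ⟨(-c) • P₂, (-c) • P₁, h₂.smul (neg_nonneg.mpr hc), h₁.smul (neg_nonneg.mpr hc), ?_⟩
      rw [smul_sub, neg_smul, neg_smul]
      abel

/-- `𝒜ʳ`, the linear span of the set `𝒜⁺` of the positive members of `𝒜`. -/
def posSpan (𝒜 : Submodule ℝ (HomPoly n E F)) : Submodule ℝ (HomPoly n E F) :=
  Submodule.span ℝ {Q | Q ∈ 𝒜 ∧ IsPositive Q}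

theorem posSpan_le (𝒜 : Submodule ℝ (HomPoly n E F)) : posSpan 𝒜 ≤ 𝒜 :=
  Submodule.span_le.mpr fun _ hQ => hQ.1

theorem posSpan_le_regular [IsOrderedAddMonoid F] [IsOrderedModule ℝ F]
    (𝒜 : Submodule ℝ (HomPoly n E F)) : posSpan 𝒜 ≤ regular n E F :=
  Submodule.span_le.mpr fun Q hQ => ⟨Q, 0, hQ.2, isPositive_zero, by simp⟩

/-- The `𝒜`-domination property: `0 ≤ P ≤ Q ∈ 𝒜` implies `P ∈ 𝒜`. -/
def DominationProperty [IsOrderedAddMonoid E] [IsOrderedAddMonoid F]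
    (𝒜 : Submodule ℝ (HomPoly n E F)) : Prop :=
  ∀ P Q : HomPoly n E F, IsPositive P → IsPositive Q → P ≤ Q → Q ∈ 𝒜 → P ∈ 𝒜

/-- `|P| ≤ Q`, where `|P|` is the absolute value of `P` in the space of regular polynomials. -/
def ModulusLE [IsOrderedAddMonoid E] [IsOrderedAddMonoid F] [IsOrderedModule ℝ F]
    (P : regular n E F) (Q : HomPoly n E F) : Prop :=
  ∃ M : regular n E F, IsModulus P M ∧ (M : HomPoly n E F) ≤ Q

/-- `‖P‖_{𝒜,r} = inf {‖Q‖_𝒜 : Q ∈ 𝒜⁺, Q ≥ |P|}`, for the norm `N = ‖·‖_𝒜` on `𝒜`. -/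
def rNorm [IsOrderedAddMonoid E] [IsOrderedAddMonoid F] [IsOrderedModule ℝ F]
    (𝒜 : Submodule ℝ (HomPoly n E F)) (N : 𝒜 → ℝ) (P : posSpan 𝒜) : ℝ :=
  sInf {r | ∃ Q : 𝒜, IsPositive (Q : HomPoly n E F) ∧
    ModulusLE (Submodule.inclusion (posSpan_le_regular 𝒜) P) Q ∧ r = N Q}

end Order

section Norm

variable [NormedAddCommGroup E] [NormedSpace ℝ E] [NormedAddCommGroup F] [NormedSpace ℝ F]

variable (n E F) in
/-- The space `𝒫(ⁿE; F)` of continuous `n`-homogeneous polynomials. -/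
def continuousPoly : Submodule ℝ (HomPoly n E F) where
  carrier := {P | Continuous P}
  zero_mem' := (continuous_const : Continuous fun _ : E => (0 : F))
  add_mem' := fun {P Q} (hP : Continuous P) (hQ : Continuous Q) =>
    (hP.add hQ : Continuous fun x => P x + Q x)
  smul_mem' := fun c P (hP : Continuous P) => (hP.const_smul c : Continuous fun x => c • P x)

/-- The sup norm `‖P‖ = sup {‖P x‖ : ‖x‖ ≤ 1}`. The supremum is finite if `P` is continuous, and
also if `P` is positive and `E`, `F` are Banach lattices, since `P` is then continuous. -/
def supNorm (P : HomPoly n E F) : ℝ :=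
  sSup {r | ∃ x : E, ‖x‖ ≤ 1 ∧ r = ‖P x‖}

/-- The regular norm `‖P‖_r = inf {‖Q‖ : Q positive, Q ≥ |P|}`. -/
def regNorm [Lattice E] [IsOrderedAddMonoid E] [PartialOrder F] [IsOrderedAddMonoid F]
    [IsOrderedModule ℝ F] (P : regular n E F) : ℝ :=
  sInf {r | ∃ Q : HomPoly n E F, IsPositive Q ∧ ModulusLE P Q ∧ r = supNorm Q}

end Norm

end HomPoly

end Polynomials

end

/-! Write `N` for the norm of `𝒜`. The proof has an algebraic and an analytic half.

Algebraic half: regular polynomials have absolute values. If `T` is the symmetric multilinear map of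
`P`, then `|T|` is subadditive on the positive cone in each variable and lies below a positive
multilinear map. Replacing it, one variable at a time, by the supremum of its sums over partitions
of that variable gives the least additive majorant (`exists_least_additive`). Minimality forces
positive homogeneity and symmetry, so the majorant extends from the cone to a symmetric multilinear
map (`exists_least_ge_neg`). Hence `|P| ≤ Q` just means `±P ≤ Q` (`modulusLE_iff`), and the r-norm
is an infimum over the `Q` in `𝒜` with `±P ≤ Q`.

Analytic half: `𝒜` is an ordered Banach space with two properties. By (I) point evaluations are
continuous, and positivity can be tested on polarization sums, so the cone is closed. If `±P ≤ Q`,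
then `|P x| ≤ Q |x|`, so (II) gives `N P ≤ N Q`. In any such space the dominated norm is complete on
the span of the cone (`isCompleteNorm_dominatedNorm`): along a fast Cauchy sequence the dominators
of the increments are summable, and the tails of their series dominate the distance to the limit.

Under the domination property, `|P| ≤ Q ∈ 𝒜` puts `|P|` into `𝒜`, which yields the lattice and ideal
statements. -/

noncomputable section

/-! ### Polarization and positivity of homogeneous polynomials -/

section Polarization

variable {n : ℕ} {E F : Type*} [AddCommGroup E] [Module ℝ E] [AddCommGroup F] [Module ℝ F]

/-- The polarization sum of a function `P`, which recovers `n !` times the symmetric multilinear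
map associated with an `n`-homogeneous polynomial. -/
def polarSum (P : E → F) (v : Fin n → E) : F :=
  ∑ t : Finset (Fin n), (-1 : ℝ) ^ t.card • P (∑ i ∈ tᶜ, v i)

/-- The sets `t` that count are the subsets of the complement of the range of `r`; their alternating
sum vanishes unless that complement is empty. -/
theorem sum_neg_one_pow_card_disjoint_range (r : Fin n → Fin n) :
    (∑ t : Finset (Fin n), if ∀ i, r i ∈ tᶜ then (-1 : ℝ) ^ t.card else 0) =
      if Function.Surjective r then 1 else 0 := by
  classical
  have h1 : ∀ t : Finset (Fin n), (∀ i, r i ∈ tᶜ) ↔ t ∈ ((Finset.univ.image r)ᶜ).powerset := by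
    intro t
    rw [Finset.mem_powerset]
    constructor
    · intro h j hj
      rw [Finset.mem_compl, Finset.mem_image]
      rintro ⟨i, -, rfl⟩
      exact (Finset.mem_compl.mp (h i)) hj
    · intro h i
      rw [Finset.mem_compl]
      intro hi
      have := h hi
      simp at this
  simp_rw [h1]
  rw [← Finset.sum_filter, Finset.filter_mem_eq_inter, Finset.univ_inter]
  have h2 := congrArg (Int.cast : ℤ → ℝ)
    (Finset.sum_powerset_neg_one_pow_card (x := (Finset.univ.image r)ᶜ))
  push_cast at h2
  rw [h2]
  have h3 : (Finset.univ.image r)ᶜ = ∅ ↔ Function.Surjective r := by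
    rw [Finset.compl_eq_empty_iff, Finset.eq_univ_iff_forall]
    simp [Function.Surjective]
  simp only [h3]

/-- Expanding each `P (∑ i ∈ tᶜ, v i)` gives one term per map `r` from indices to indices. The signs
cancel the non-surjective `r`; the remaining `n !` permutations all contribute `T v` by symmetry. -/
theorem polarSum_eq {T : MultilinearMap ℝ (fun _ : Fin n => E) F} {P : E → F}
    (h : IsAssociated T P) (v : Fin n → E) : polarSum P v = (n.factorial : ℝ) • T v := by
  classical
  have h1 : ∀ t : Finset (Fin n), (-1 : ℝ) ^ t.card • P (∑ i ∈ tᶜ, v i) =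
      ∑ r : Fin n → Fin n,
        (if ∀ i, r i ∈ tᶜ then (-1 : ℝ) ^ t.card else 0) • T fun i => v (r i) := by
    intro t
    rw [h.2, T.map_sum_finset (fun _ j => v j) (fun _ => tᶜ), Finset.smul_sum]
    simp_rw [ite_smul, zero_smul, ← Finset.sum_filter]
    refine Finset.sum_congr ?_ fun _ _ => rfl
    ext r
    simp [Fintype.mem_piFinset]
  rw [polarSum, Finset.sum_congr rfl fun t _ => h1 t, Finset.sum_comm]
  simp_rw [← Finset.sum_smul, sum_neg_one_pow_card_disjoint_range, ite_smul, zero_smul, one_smul]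
  rw [← Finset.sum_filter]
  have h2 : ∑ r : Fin n → Fin n with Function.Surjective r, (T fun i => v (r i)) =
      ∑ _σ : Equiv.Perm (Fin n), T v := by
    refine (Finset.sum_bij (fun (σ : Equiv.Perm (Fin n)) _ => (σ : Fin n → Fin n)) ?_ ?_ ?_ ?_).symm
    · intro σ _
      simpa using σ.surjective
    · intro σ _ τ _ hστ
      exact DFunLike.coe_injective hστ
    · intro r hr
      have hr' : Function.Surjective r := by simpa using hr
      exact ⟨Equiv.ofBijective r (Finite.surjective_iff_bijective.mp hr'), Finset.mem_univ _, rfl⟩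
    · intro σ _
      exact (h.1 σ v).symm
  rw [h2, Finset.sum_const, Finset.card_univ, Fintype.card_perm, Fintype.card_fin,
    Nat.cast_smul_eq_nsmul]

theorem IsAssociated.unique {T S : MultilinearMap ℝ (fun _ : Fin n => E) F} {P : E → F}
    (hT : IsAssociated T P) (hS : IsAssociated S P) : T = S := by
  ext v
  have h := (polarSum_eq hT v).symm.trans (polarSum_eq hS v)
  exact smul_right_injective F (Nat.cast_ne_zero.mpr n.factorial_ne_zero) h

namespace HomPoly

theorem exists_isAssociated (P : HomPoly n E F) :
    ∃ T : MultilinearMap ℝ (fun _ : Fin n => E) F, IsAssociated T P := P.2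

/-- The symmetric multilinear map of a homogeneous polynomial. -/
def toMultilinear (P : HomPoly n E F) : MultilinearMap ℝ (fun _ : Fin n => E) F :=
  P.exists_isAssociated.choose

theorem isAssociated_toMultilinear (P : HomPoly n E F) : IsAssociated P.toMultilinear P :=
  P.exists_isAssociated.choose_spec

theorem apply_eq_toMultilinear (P : HomPoly n E F) (x : E) : P x = P.toMultilinear fun _ => x :=
  P.isAssociated_toMultilinear.2 x

theorem toMultilinear_sub (P Q : HomPoly n E F) :
    (P - Q).toMultilinear = P.toMultilinear - Q.toMultilinear := by
  refine (P - Q).isAssociated_toMultilinear.unique ⟨fun σ v => ?_, fun x => ?_⟩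
  · simp [P.isAssociated_toMultilinear.1 σ v, Q.isAssociated_toMultilinear.1 σ v]
  · rw [sub_apply, apply_eq_toMultilinear, apply_eq_toMultilinear Q]
    rfl

theorem toMultilinear_neg (P : HomPoly n E F) :
    (-P).toMultilinear = -P.toMultilinear := by
  refine (-P).isAssociated_toMultilinear.unique ⟨fun σ v => ?_, fun x => ?_⟩
  · simp [P.isAssociated_toMultilinear.1 σ v]
  · rw [neg_apply, apply_eq_toMultilinear]
    rfl

theorem map_smul_eq (P : HomPoly n E F) (c : ℝ) (x : E) : P (c • x) = c ^ n • P x := by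
  rw [apply_eq_toMultilinear, apply_eq_toMultilinear,
    P.toMultilinear.map_smul_univ (fun _ => c) fun _ => x]
  simp

section Order

variable [Lattice E] [PartialOrder F]

theorem isPositive_iff_toMultilinear (P : HomPoly n E F) :
    IsPositive P ↔ ∀ v : Fin n → E, (∀ i, 0 ≤ v i) → 0 ≤ P.toMultilinear v := by
  constructor
  · rintro ⟨T, hT, hT0⟩
    rwa [P.isAssociated_toMultilinear.unique hT]
  · exact fun h => ⟨_, P.isAssociated_toMultilinear, h⟩

/-- Positivity is thus a condition on finite combinations of point evaluations, which is what makes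
the cone closed under pointwise limits. -/
theorem isPositive_iff_polarSum [IsOrderedAddMonoid F] [IsOrderedModule ℝ F]
    (P : HomPoly n E F) :
    IsPositive P ↔ ∀ v : Fin n → E, (∀ i, 0 ≤ v i) → 0 ≤ polarSum P v := by
  have h0 : (0 : ℝ) < n.factorial := Nat.cast_pos.mpr n.factorial_pos
  rw [isPositive_iff_toMultilinear]
  refine forall₂_congr fun v _ => ?_
  rw [polarSum_eq P.isAssociated_toMultilinear]
  refine ⟨fun h => smul_nonneg h0.le h, fun h => ?_⟩
  have h1 := smul_nonneg (inv_nonneg.mpr h0.le) h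
  rwa [smul_smul, inv_mul_cancel₀ h0.ne', one_smul] at h1

end Order

end HomPoly

end Polarization

/-! ### Riesz decomposition and sums over partitions -/

section Partitions

theorem list_sum_map_le {α F : Type*} [AddCommGroup F] [PartialOrder F] [IsOrderedAddMonoid F]
    {h k : α → F} {l : List α} (H : ∀ u ∈ l, h u ≤ k u) :
    (l.map h).sum ≤ (l.map k).sum := by
  induction l with
  | nil => simp
  | cons u l ih =>
    simp only [List.map_cons, List.sum_cons]
    exact add_le_add (H u List.mem_cons_self) (ih fun w hw => H w (List.mem_cons_of_mem _ hw))

variable {E F : Type*} [AddCommGroup E] [Lattice E]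
  [AddCommGroup F]

/-- `l` is a finite list of nonnegative vectors with sum `x`. -/
def IsPartition (l : List E) (x : E) : Prop := (∀ u ∈ l, 0 ≤ u) ∧ l.sum = x

/-- The function `h` is additive on the positive cone. -/
def ConeAdditive (h : E → F) : Prop := ∀ x y, 0 ≤ x → 0 ≤ y → h (x + y) = h x + h y

/-- The sums of `h` over partitions of `x`. -/
def partitionSums (h : E → F) (x : E) : Set F := {r | ∃ l, IsPartition l x ∧ r = (l.map h).sum}

theorem ConeAdditive.map_zero {h : E → F} (hh : ConeAdditive h) : h 0 = 0 := by
  have := hh 0 0 le_rfl le_rfl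
  simpa using this

theorem isPartition_singleton {x : E} (hx : 0 ≤ x) : IsPartition [x] x :=
  ⟨by simpa using hx, by simp⟩

theorem partitionSums_nonempty (h : E → F) {x : E} (hx : 0 ≤ x) : (partitionSums h x).Nonempty :=
  ⟨_, [x], isPartition_singleton hx, rfl⟩

theorem IsPartition.append {l m : List E} {x y : E} (hl : IsPartition l x)
    (hm : IsPartition m y) : IsPartition (l ++ m) (x + y) := by
  refine ⟨fun u hu => ?_, by rw [List.sum_append, hl.2, hm.2]⟩
  rcases List.mem_append.mp hu with hu | hu
  exacts [hl.1 u hu, hm.1 u hu]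

theorem ConeAdditive.map_sum {s : E → F} [IsOrderedAddMonoid E] (hs : ConeAdditive s) {l : List E}
    {x : E} (hl : IsPartition l x) : (l.map s).sum = s x := by
  induction l generalizing x with
  | nil => simp [← hl.2, hs.map_zero]
  | cons u l ih =>
    have h0 : ∀ w ∈ l, 0 ≤ w := fun w hw => hl.1 w (List.mem_cons_of_mem _ hw)
    rw [List.map_cons, List.sum_cons, ih ⟨h0, rfl⟩, ← hl.2, List.sum_cons,
      hs _ _ (hl.1 u List.mem_cons_self) (List.sum_nonneg h0)]

variable [PartialOrder F]

/-- The function `h` is subadditive on the positive cone and vanishes at zero. -/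
structure ConeSubadditive (h : E → F) : Prop where
  zero : h 0 = 0
  add_le : ∀ x y, 0 ≤ x → 0 ≤ y → h (x + y) ≤ h x + h y

/-- A least upper bound of `s` if there is one. -/
def chosenLUB (s : Set F) : F :=
  open Classical in if h : ∃ a, IsLUB s a then h.choose else 0

theorem isLUB_chosenLUB (hF : IsDedekindComplete F) {s : Set F} (hs : s.Nonempty)
    (hb : BddAbove s) : IsLUB s (chosenLUB s) := by
  have h := hF s hs hb
  rw [chosenLUB, dif_pos h]
  exact h.choose_spec

theorem ConeAdditive.coneSubadditive {h : E → F} (hh : ConeAdditive h) : ConeSubadditive h :=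
  ⟨hh.map_zero, fun x y hx hy => (hh x y hx hy).le⟩

variable [IsOrderedAddMonoid F] [IsOrderedAddMonoid E]

theorem ConeSubadditive.le_sum {h : E → F} (hh : ConeSubadditive h) {l : List E} {x : E}
    (hl : IsPartition l x) : h x ≤ (l.map h).sum := by
  induction l generalizing x with
  | nil => simp [← hl.2, hh.zero]
  | cons u l ih =>
    have h0 : ∀ w ∈ l, 0 ≤ w := fun w hw => hl.1 w (List.mem_cons_of_mem _ hw)
    rw [List.map_cons, List.sum_cons, ← hl.2, List.sum_cons]
    exact (hh.add_le _ _ (hl.1 u List.mem_cons_self) (List.sum_nonneg h0)).trans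
      (by gcongr; exact ih ⟨h0, rfl⟩)

/-- Riesz decomposition: a partition of `x + y` can be refined to partitions of `x` and `y`. -/
theorem IsPartition.split {l : List E} {x y : E} (hl : IsPartition l (x + y)) (hx : 0 ≤ x)
    (hy : 0 ≤ y) : ∃ l₁ l₂, IsPartition l₁ x ∧ IsPartition l₂ y ∧
      ∀ h : E → F, ConeSubadditive h → (l.map h).sum ≤ (l₁.map h).sum + (l₂.map h).sum := by
  induction l generalizing x y with
  | nil =>
    have h0 : x + y = 0 := by simpa using hl.2.symm
    obtain ⟨rfl, rfl⟩ := (add_eq_zero_iff_of_nonneg hx hy).mp h0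
    exact ⟨[], [], ⟨by simp, by simp⟩, ⟨by simp, by simp⟩, fun h _ => by simp⟩
  | cons u l ih =>
    have hu : 0 ≤ u := hl.1 u List.mem_cons_self
    have h0 : ∀ w ∈ l, 0 ≤ w := fun w hw => hl.1 w (List.mem_cons_of_mem _ hw)
    have hsum : u + l.sum = x + y := by simpa using hl.2
    have hux : u ⊓ x ≤ u := inf_le_left
    -- The piece `u` gives `u ⊓ x` to `x` and the rest to `y`; the rest fits because `u ≤ u + y` and
    -- `u ≤ x + y`.
    have huy : u - u ⊓ x ≤ y := by
      rw [sub_le_iff_le_add, add_inf, le_inf_iff]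
      refine ⟨le_add_of_nonneg_left hy, ?_⟩
      rw [add_comm y x, ← hsum]
      exact le_add_of_nonneg_right (List.sum_nonneg h0)
    obtain ⟨l₁, l₂, h₁, h₂, hle⟩ := ih (x := x - u ⊓ x) (y := y - (u - u ⊓ x))
      ⟨h0, by rw [eq_sub_of_add_eq' hsum]; abel⟩ (sub_nonneg.mpr inf_le_right)
      (sub_nonneg.mpr huy)
    refine ⟨u ⊓ x :: l₁, (u - u ⊓ x) :: l₂, ⟨?_, ?_⟩, ⟨?_, ?_⟩, fun h hh => ?_⟩
    · intro w hw
      rcases List.mem_cons.mp hw with rfl | hw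
      exacts [le_inf hu hx, h₁.1 w hw]
    · rw [List.sum_cons, h₁.2]; abel
    · intro w hw
      rcases List.mem_cons.mp hw with rfl | hw
      exacts [sub_nonneg.mpr hux, h₂.1 w hw]
    · rw [List.sum_cons, h₂.2]; abel
    · simp only [List.map_cons, List.sum_cons]
      have h3 := hh.add_le (u ⊓ x) (u - u ⊓ x) (le_inf hu hx) (sub_nonneg.mpr hux)
      rw [add_sub_cancel] at h3
      refine (add_le_add h3 (hle h hh)).trans_eq ?_
      abel

/-- Two partitions of the same vector have a common refinement. -/
theorem IsPartition.exists_refinement {l m : List E} {x : E} (hl : IsPartition l x)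
    (hm : IsPartition m x) : ∃ r, IsPartition r x ∧ ∀ h : E → F, ConeSubadditive h →
      (l.map h).sum ≤ (r.map h).sum ∧ (m.map h).sum ≤ (r.map h).sum := by
  induction l generalizing m x with
  | nil =>
    exact ⟨m, hm, fun h hh => ⟨by
      have := hh.le_sum hm
      simpa [← hl.2, hh.zero] using this, le_rfl⟩⟩
  | cons u l ih =>
    have hu : 0 ≤ u := hl.1 u List.mem_cons_self
    have h0 : ∀ w ∈ l, 0 ≤ w := fun w hw => hl.1 w (List.mem_cons_of_mem _ hw)
    have hsum : u + l.sum = x := by simpa using hl.2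
    subst hsum
    -- Cut `m` into a partition of `u` and one of the remaining sum; only the latter still has to be
    -- refined against `l`.
    obtain ⟨m₁, m₂, h₁, h₂, hle⟩ := hm.split (F := F) hu (List.sum_nonneg h0)
    obtain ⟨r, hr, hr'⟩ := ih ⟨h0, rfl⟩ h₂
    refine ⟨m₁ ++ r, h₁.append hr, fun h hh => ?_⟩
    simp only [List.map_cons, List.sum_cons, List.map_append, List.sum_append]
    exact ⟨add_le_add (hh.le_sum h₁) (hr' h hh).1, (hle h hh).trans (by gcongr; exact (hr' h hh).2)⟩

theorem isLUB_partitionSums (hF : IsDedekindComplete F) {h s : E → F}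
    (hs : ConeAdditive s) (hle : ∀ x, 0 ≤ x → h x ≤ s x) {x : E} (hx : 0 ≤ x) :
    IsLUB (partitionSums h x) (chosenLUB (partitionSums h x)) := by
  refine isLUB_chosenLUB hF (partitionSums_nonempty h hx) ⟨s x, ?_⟩
  rintro _ ⟨l, hl, rfl⟩
  exact (list_sum_map_le fun u hu => hle u (hl.1 u hu)).trans_eq (hs.map_sum hl)

theorem IsLUB.add_le_of_forall {A B : Set F} {a b c : F} (ha : IsLUB A a) (hb : IsLUB B b)
    (h : ∀ p ∈ A, ∀ q ∈ B, p + q ≤ c) : a + b ≤ c := by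
  rw [← le_sub_iff_add_le']
  refine hb.2 fun q hq => ?_
  rw [le_sub_comm]
  exact ha.2 fun p hp => le_sub_iff_add_le.mpr (h p hp q hq)

end Partitions

/-! ### Least additive majorant in several variables -/

section MultiAdditive

open Function

variable {ι E F : Type*} [DecidableEq ι] [AddCommGroup E] [Lattice E]
  [AddCommGroup F] [PartialOrder F]

/-- `f` is subadditive on the positive cone in each variable. -/
def MultiSubadditive (f : (ι → E) → F) : Prop :=
  ∀ k v, 0 ≤ v → ConeSubadditive fun u => f (update v k u)

/-- `f` is additive on the positive cone in the variable `k`. -/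
def AdditiveIn (k : ι) (f : (ι → E) → F) : Prop :=
  ∀ v, 0 ≤ v → ConeAdditive fun u => f (update v k u)

/-- The supremum of the sums of `f` over the partitions of the variable `k`. -/
def additivization (k : ι) (f : (ι → E) → F) (v : ι → E) : F :=
  chosenLUB (partitionSums (fun u => f (update v k u)) (v k))

theorem update_nonneg {v : ι → E} (hv : 0 ≤ v) (k : ι) {x : E} (hx : 0 ≤ x) :
    0 ≤ update v k x := by
  intro i
  rcases eq_or_ne i k with rfl | hi
  · simpa using hx
  · simpa [hi] using hv i

variable [IsOrderedAddMonoid E] [IsOrderedAddMonoid F] {k : ι} {f S : (ι → E) → F}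

theorem isLUB_additivization (hF : IsDedekindComplete F) (hS : AdditiveIn k S)
    (hfS : ∀ v, 0 ≤ v → f v ≤ S v) {v : ι → E} (hv : 0 ≤ v) :
    IsLUB (partitionSums (fun u => f (update v k u)) (v k)) (additivization k f v) :=
  isLUB_partitionSums hF (hS v hv) (fun _ hx => hfS _ (update_nonneg hv k hx)) (hv k)

theorem le_additivization (hF : IsDedekindComplete F) (hS : AdditiveIn k S)
    (hfS : ∀ v, 0 ≤ v → f v ≤ S v) {v : ι → E} (hv : 0 ≤ v) : f v ≤ additivization k f v :=
  (isLUB_additivization hF hS hfS hv).1 ⟨[v k], isPartition_singleton (hv k), by simp⟩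

theorem additivization_le (hF : IsDedekindComplete F) (hS : AdditiveIn k S)
    (hfS : ∀ v, 0 ≤ v → f v ≤ S v) {v : ι → E} (hv : 0 ≤ v) : additivization k f v ≤ S v := by
  refine (isLUB_additivization hF hS hfS hv).2 ?_
  rintro _ ⟨l, hl, rfl⟩
  refine (list_sum_map_le fun u hu => hfS _ (update_nonneg hv k (hl.1 u hu))).trans_eq ?_
  rw [(hS v hv).map_sum hl, update_eq_self]

/-- Splitting a partition of `x + y` gives `≤`, since subadditivity makes sums grow under
refinement; concatenating partitions gives `≥`. -/
theorem additiveIn_additivization (hF : IsDedekindComplete F) (hS : AdditiveIn k S)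
    (hfS : ∀ v, 0 ≤ v → f v ≤ S v) (hf : MultiSubadditive f) :
    AdditiveIn k (additivization k f) := by
  intro v hv x y hx hy
  have hlub : ∀ z, 0 ≤ z → IsLUB (partitionSums (fun u => f (update v k u)) z)
      (additivization k f (update v k z)) := fun z hz => by
    simpa using isLUB_additivization hF hS hfS (update_nonneg hv k hz)
  apply le_antisymm
  · refine (hlub _ (add_nonneg hx hy)).2 ?_
    rintro _ ⟨l, hl, rfl⟩
    obtain ⟨l₁, l₂, h₁, h₂, hle⟩ := hl.split (F := F) hx hy
    exact (hle _ (hf k v hv)).trans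
      (add_le_add ((hlub x hx).1 ⟨l₁, h₁, rfl⟩) ((hlub y hy).1 ⟨l₂, h₂, rfl⟩))
  · refine (hlub x hx).add_le_of_forall (hlub y hy) ?_
    rintro _ ⟨l, hl, rfl⟩ _ ⟨m, hm, rfl⟩
    exact (hlub _ (add_nonneg hx hy)).1 ⟨l ++ m, hl.append hm, by simp⟩

theorem isLUB_additivization_update (hF : IsDedekindComplete F) (hS : AdditiveIn k S)
    (hfS : ∀ v, 0 ≤ v → f v ≤ S v) {j : ι} (hj : j ≠ k) {v : ι → E} (hv : 0 ≤ v) {z : E}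
    (hz : 0 ≤ z) :
    IsLUB (partitionSums (fun u => f (update (update v k u) j z)) (v k))
      (additivization k f (update v j z)) := by
  simpa [update_comm hj, hj.symm] using isLUB_additivization hF hS hfS (update_nonneg hv j hz)

theorem multiSubadditive_additivization (hF : IsDedekindComplete F) (hS : AdditiveIn k S)
    (hfS : ∀ v, 0 ≤ v → f v ≤ S v) (hf : MultiSubadditive f) :
    MultiSubadditive (additivization k f) := by
  intro j v hv
  rcases eq_or_ne j k with rfl | hj
  · exact (additiveIn_additivization hF hS hfS hf v hv).coneSubadditive
  have hlub := fun {z : E} (hz : 0 ≤ z) => isLUB_additivization_update hF hS hfS hj hv hz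
  have hsub : ∀ u, 0 ≤ u → ConeSubadditive fun z => f (update (update v k u) j z) :=
    fun u hu => hf j _ (update_nonneg hv k hu)
  refine ⟨?_, fun x y hx hy => ?_⟩
  · have h0 : ∀ l, IsPartition l (v k) →
        (l.map fun u => f (update (update v k u) j 0)).sum = 0 := by
      intro l hl
      refine List.sum_eq_zero fun r hr => ?_
      obtain ⟨u, hu, rfl⟩ := List.mem_map.mp hr
      exact (hsub u (hl.1 u hu)).zero
    apply le_antisymm
    · refine (hlub le_rfl).2 ?_
      rintro _ ⟨l, hl, rfl⟩
      exact (h0 l hl).le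
    · exact (h0 _ (isPartition_singleton (hv k))).ge.trans
        ((hlub le_rfl).1 ⟨_, isPartition_singleton (hv k), rfl⟩)
  · refine (hlub (add_nonneg hx hy)).2 ?_
    rintro _ ⟨l, hl, rfl⟩
    refine le_trans ?_ (add_le_add ((hlub hx).1 ⟨l, hl, rfl⟩) ((hlub hy).1 ⟨l, hl, rfl⟩))
    rw [← List.sum_map_add]
    exact list_sum_map_le fun u hu => (hsub u (hl.1 u hu)).add_le x y hx hy

/-- Treating a new variable must not destroy additivity already gained. The suprema at `x` and at
`y` may use different partitions of variable `k`, but a common refinement serves both, and on a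
single partition additivity in `j` holds termwise. -/
theorem AdditiveIn.additivization_of_le {j : ι} (hfj : AdditiveIn j f)
    (hF : IsDedekindComplete F) (hS : AdditiveIn k S) (hfS : ∀ v, 0 ≤ v → f v ≤ S v)
    (hf : MultiSubadditive f) :
    AdditiveIn j (additivization k f) := by
  rcases eq_or_ne j k with rfl | hj
  · exact additiveIn_additivization hF hS hfS hf
  intro v hv x y hx hy
  have hlub := fun {z : E} (hz : 0 ≤ z) => isLUB_additivization_update hF hS hfS hj hv hz
  refine le_antisymm ((multiSubadditive_additivization hF hS hfS hf j v hv).add_le x y hx hy) ?_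
  refine (hlub hx).add_le_of_forall (hlub hy) ?_
  rintro _ ⟨l, hl, rfl⟩ _ ⟨m, hm, rfl⟩
  obtain ⟨r, hr, hle⟩ := hl.exists_refinement (F := F) hm
  have hsub : ∀ z, 0 ≤ z → ConeSubadditive fun u => f (update (update v k u) j z) := by
    intro z hz
    simpa only [update_comm hj] using hf k _ (update_nonneg hv j hz)
  refine (add_le_add (hle _ (hsub x hx)).1 (hle _ (hsub y hy)).2).trans ?_
  refine le_trans (le_of_eq ?_) ((hlub (add_nonneg hx hy)).1 ⟨r, hr, rfl⟩)
  rw [← List.sum_map_add]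
  congr 1
  exact List.map_congr_left fun u hu => (hfj _ (update_nonneg hv k (hr.1 u hu)) x y hx hy).symm

/-- A subadditive function of several variables that is dominated by an additive one lies below
a least additive one. -/
theorem exists_least_additive [Finite ι] (hF : IsDedekindComplete F) (hS : ∀ k, AdditiveIn k S)
    (hfS : ∀ v, 0 ≤ v → f v ≤ S v) (hf : MultiSubadditive f) :
    ∃ g : (ι → E) → F, (∀ k, AdditiveIn k g) ∧ (∀ v, 0 ≤ v → f v ≤ g v) ∧
      ∀ R : (ι → E) → F, (∀ k, AdditiveIn k R) → (∀ v, 0 ≤ v → f v ≤ R v) →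
        ∀ v, 0 ≤ v → g v ≤ R v := by
  cases nonempty_fintype ι
  -- Induction on the set of variables already treated. Subadditivity in all variables is carried
  -- along because the next supremum needs it.
  suffices H : ∀ K : Finset ι, ∃ g : (ι → E) → F, MultiSubadditive g ∧
      (∀ k ∈ K, AdditiveIn k g) ∧ (∀ v, 0 ≤ v → f v ≤ g v) ∧
      ∀ R : (ι → E) → F, (∀ k, AdditiveIn k R) → (∀ v, 0 ≤ v → f v ≤ R v) →
        ∀ v, 0 ≤ v → g v ≤ R v by
    obtain ⟨g, -, h1, h2, h3⟩ := H Finset.univ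
    exact ⟨g, fun k => h1 k (Finset.mem_univ k), h2, h3⟩
  intro K
  induction K using Finset.induction_on with
  | empty => exact ⟨f, hf, by simp, fun _ _ => le_rfl, fun R _ hR => hR⟩
  | insert k K _ ih =>
    obtain ⟨g, h0, h1, h2, h3⟩ := ih
    -- Minimality of `g` against `S` bounds the partition sums of `g`, so their supremum exists.
    have hgS := h3 S hS hfS
    refine ⟨additivization k g, multiSubadditive_additivization hF (hS k) hgS h0, fun j hj => ?_,
      fun v hv => (h2 v hv).trans (le_additivization hF (hS k) hgS hv),
      fun R hR hfR v hv => additivization_le hF (hR k) (h3 R hR hfR) hv⟩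
    rcases Finset.mem_insert.mp hj with rfl | hj
    · exact additiveIn_additivization hF (hS j) hgS h0
    · exact (h1 j hj).additivization_of_le hF (hS k) hgS h0

end MultiAdditive

/-! ### Extension from the positive cone to a multilinear map -/

section Extension

open Function

variable {ι E F : Type*} [DecidableEq ι] [AddCommGroup E] [Module ℝ E] [Lattice E]
  [AddCommGroup F] [Module ℝ F]

/-- `g` is linear in the variables that belong to `K`, and additive and positively homogeneous
on the positive cone in the other ones. -/
structure PartlyLinear (K : Finset ι) (g : (ι → E) → F) : Prop where
  add : ∀ v k x y, (∀ i, i ≠ k → i ∉ K → 0 ≤ v i) → (k ∉ K → 0 ≤ x ∧ 0 ≤ y) →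
    g (update v k (x + y)) = g (update v k x) + g (update v k y)
  smul : ∀ v k (c : ℝ) x, (∀ i, i ≠ k → i ∉ K → 0 ≤ v i) → (k ∉ K → 0 ≤ c ∧ 0 ≤ x) →
    g (update v k (c • x)) = c • g (update v k x)

/-- The extension of `g` in the variable `k` from the positive cone. -/
def extendIn (k : ι) (g : (ι → E) → F) (v : ι → E) : F :=
  g (update v k (v k)⁺) - g (update v k (v k)⁻)

variable {K : Finset ι} {g : (ι → E) → F} {k : ι}

theorem PartlyLinear.map_update_zero (hg : PartlyLinear K g) {v : ι → E}
    (hv : ∀ i, i ≠ k → i ∉ K → 0 ≤ v i) : g (update v k 0) = 0 := by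
  simpa using hg.smul v k 0 0 hv fun _ => ⟨le_rfl, le_rfl⟩

variable [IsOrderedAddMonoid E]

theorem PartlyLinear.extendIn_eq (hg : PartlyLinear K g) {v : ι → E} (hv : 0 ≤ v) :
    extendIn k g v = g v := by
  rw [extendIn, posPart_of_nonneg (hv k), negPart_of_nonneg (hv k), update_eq_self,
    hg.map_update_zero fun i _ _ => hv i, sub_zero]

/-- The extension does not depend on how a vector is written as a difference of positive ones: `a -
b = x⁺ - x⁻` means `x⁺ + b = a + x⁻`, and `g` is additive there. -/
theorem PartlyLinear.extendIn_update_sub (hg : PartlyLinear K g) {v : ι → E}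
    (hv : ∀ i, i ≠ k → i ∉ K → 0 ≤ v i) {a b : E} (ha : 0 ≤ a) (hb : 0 ≤ b) :
    extendIn k g (update v k (a - b)) = g (update v k a) - g (update v k b) := by
  simp only [extendIn, update_self, update_idem]
  rw [sub_eq_sub_iff_add_eq_add, ← hg.add v k _ _ hv fun _ => ⟨posPart_nonneg _, hb⟩,
    ← hg.add v k _ _ hv fun _ => ⟨ha, negPart_nonneg _⟩]
  congr 2
  rw [← sub_eq_sub_iff_add_eq_add, posPart_sub_negPart]

theorem PartlyLinear.extendIn_update (hg : PartlyLinear K g) {v : ι → E}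
    (hv : ∀ i, i ≠ k → i ∉ K → 0 ≤ v i) (x : E) :
    extendIn k g (update v k x) = g (update v k x⁺) - g (update v k x⁻) := by
  simpa using hg.extendIn_update_sub hv (posPart_nonneg x) (negPart_nonneg x)

theorem PartlyLinear.insert_extendIn [IsOrderedModule ℝ E] (hg : PartlyLinear K g) :
    PartlyLinear (insert k K) (extendIn k g) := by
  have hdom : ∀ {v : ι → E}, (∀ i, i ≠ k → i ∉ insert k K → 0 ≤ v i) →
      ∀ i, i ≠ k → i ∉ K → 0 ≤ v i := fun hv i hi hiK => hv i hi (by simp [hi, hiK])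
  have hdom' : ∀ {v : ι → E} {j : ι} {z : E}, j ≠ k → 0 ≤ z →
      (∀ i, i ≠ j → i ∉ insert k K → 0 ≤ v i) →
      ∀ i, i ≠ j → i ∉ K → 0 ≤ update v k z i := by
    intro v j z hj hz hv i hi hiK
    rcases eq_or_ne i k with rfl | hik
    · simpa using hz
    · simpa [hik] using hv i hi (by simp [hik, hiK])
  have hother : ∀ (v : ι → E) {j : ι} (z : E), j ≠ k → extendIn k g (update v j z) =
      g (update (update v k (v k)⁺) j z) - g (update (update v k (v k)⁻) j z) := by
    intro v j z hj
    simp only [extendIn, update_of_ne hj.symm, update_comm hj]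
  constructor
  · intro v j x y hv hxy
    rcases eq_or_ne j k with rfl | hj
    · have hv' := hdom hv
      have h1 : x + y = (x⁺ + y⁺) - (x⁻ + y⁻) := by
        conv_lhs => rw [← posPart_sub_negPart x, ← posPart_sub_negPart y]
        abel
      rw [h1, hg.extendIn_update_sub hv' (add_nonneg (posPart_nonneg _) (posPart_nonneg _))
        (add_nonneg (negPart_nonneg _) (negPart_nonneg _)),
        hg.add v j _ _ hv' fun _ => ⟨posPart_nonneg _, posPart_nonneg _⟩,
        hg.add v j _ _ hv' fun _ => ⟨negPart_nonneg _, negPart_nonneg _⟩,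
        hg.extendIn_update hv', hg.extendIn_update hv']
      abel
    · have hxy' : j ∉ K → 0 ≤ x ∧ 0 ≤ y := fun h => hxy (by simp [hj, h])
      rw [hother v _ hj, hother v _ hj, hother v _ hj,
        hg.add _ j x y (hdom' hj (posPart_nonneg _) hv) hxy',
        hg.add _ j x y (hdom' hj (negPart_nonneg _) hv) hxy']
      abel
  · intro v j c x hv hx
    rcases eq_or_ne j k with rfl | hj
    · have hv' := hdom hv
      rw [hg.extendIn_update hv' x]
      rcases le_total 0 c with hc | hc
      · have h1 : c • x = c • x⁺ - c • x⁻ := by rw [← smul_sub, posPart_sub_negPart]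
        rw [h1, hg.extendIn_update_sub hv' (smul_nonneg hc (posPart_nonneg _))
          (smul_nonneg hc (negPart_nonneg _)), hg.smul v j c _ hv' fun _ => ⟨hc, posPart_nonneg _⟩,
          hg.smul v j c _ hv' fun _ => ⟨hc, negPart_nonneg _⟩, smul_sub]
      -- A negative scalar exchanges the roles of `x⁺` and `x⁻`.
      · have hc' : 0 ≤ -c := neg_nonneg.mpr hc
        have h1 : c • x = -c • x⁻ - -c • x⁺ := by
          rw [← smul_sub, neg_smul, ← smul_neg, neg_sub, posPart_sub_negPart]
        rw [h1, hg.extendIn_update_sub hv' (smul_nonneg hc' (negPart_nonneg _))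
          (smul_nonneg hc' (posPart_nonneg _)),
          hg.smul v j _ _ hv' fun _ => ⟨hc', posPart_nonneg _⟩,
          hg.smul v j _ _ hv' fun _ => ⟨hc', negPart_nonneg _⟩, neg_smul, neg_smul, smul_sub]
        abel
    · have hx' : j ∉ K → 0 ≤ c ∧ 0 ≤ x := fun h => hx (by simp [hj, h])
      rw [hother v _ hj, hother v _ hj,
        hg.smul _ j c x (hdom' hj (posPart_nonneg _) hv) hx',
        hg.smul _ j c x (hdom' hj (negPart_nonneg _) hv) hx', smul_sub]

theorem PartlyLinear.exists_multilinearMap [Finite ι] [IsOrderedModule ℝ E]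
    (hg : PartlyLinear ∅ g) :
    ∃ T : MultilinearMap ℝ (fun _ : ι => E) F, ∀ v, 0 ≤ v → T v = g v := by
  cases nonempty_fintype ι
  have H : ∀ K : Finset ι, ∃ g' : (ι → E) → F, PartlyLinear K g' ∧ ∀ v, 0 ≤ v → g' v = g v := by
    intro K
    induction K using Finset.induction_on with
    | empty => exact ⟨g, hg, fun _ _ => rfl⟩
    | insert k K _ ih =>
      obtain ⟨g', h1, h2⟩ := ih
      exact ⟨extendIn k g', h1.insert_extendIn, fun v hv => (h1.extendIn_eq hv).trans (h2 v hv)⟩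
  obtain ⟨g', h1, h2⟩ := H Finset.univ
  exact ⟨MultilinearMap.mk' g' (fun v k x y => h1.add v k x y (by simp) (by simp))
    (fun v k c x => h1.smul v k c x (by simp) (by simp)), h2⟩

end Extension

/-! ### Expansion into positive parts; competitors for minimality -/

section Modulus

open Function

variable {n : ℕ} {E F : Type*} [AddCommGroup E] [Module ℝ E] [Lattice E] [IsOrderedAddMonoid E]
  [AddCommGroup F] [Module ℝ F]

/-- The multilinear expansion of `T x` along `x = x⁺ - x⁻`. -/
theorem MultilinearMap.eq_sum_posPart_negPart {ι : Type*} [DecidableEq ι] [Fintype ι]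
    (T : MultilinearMap ℝ (fun _ : ι => E) F) (v : ι → E) :
    T v = ∑ t : Finset ι, (∏ i, if i ∈ t then (1 : ℝ) else -1) •
      T (t.piecewise (fun i => (v i)⁺) fun i => (v i)⁻) := by
  have h5 : v = (fun i => (v i)⁺) + fun i => -(v i)⁻ := by
    funext i
    simp [← sub_eq_add_neg]
  conv_lhs => rw [h5, MultilinearMap.map_add_univ]
  refine Finset.sum_congr rfl fun t _ => ?_
  have h6 : t.piecewise (fun i => (v i)⁺) (fun i => -(v i)⁻) = fun i =>
      (if i ∈ t then (1 : ℝ) else -1) • t.piecewise (fun i => (v i)⁺) (fun i => (v i)⁻) i := by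
    funext i
    by_cases hi : i ∈ t <;> simp [hi]
  rw [h6, MultilinearMap.map_smul_univ]

omit [Module ℝ E] [IsOrderedAddMonoid E] in
theorem piecewise_posPart_negPart_nonneg {ι : Type*} [DecidableEq ι] (t : Finset ι) (v : ι → E) :
    0 ≤ t.piecewise (fun i => (v i)⁺) fun i => (v i)⁻ := by
  intro i
  by_cases hi : i ∈ t
  · simp [hi]
  · simp [hi]

theorem MultilinearMap.ext_of_nonneg {ι : Type*} [Finite ι]
    {T S : MultilinearMap ℝ (fun _ : ι => E) F} (h : ∀ v, 0 ≤ v → T v = S v) : T = S := by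
  classical
  cases nonempty_fintype ι
  ext v
  rw [T.eq_sum_posPart_negPart, S.eq_sum_posPart_negPart]
  refine Finset.sum_congr rfl fun t _ => ?_
  rw [h _ (piecewise_posPart_negPart_nonneg t v)]

omit [Module ℝ E] [IsOrderedAddMonoid E] [Module ℝ F] in
theorem AdditiveIn.comp_perm {ι : Type*} [DecidableEq ι] {g : (ι → E) → F}
    (hg : ∀ k, AdditiveIn k g) (σ : Equiv.Perm ι) (k : ι) :
    AdditiveIn k fun v => g fun i => v (σ i) := by
  intro v hv x y hx hy
  have h : ∀ z, (fun i => update v k z (σ i)) = update (fun i => v (σ i)) (σ.symm k) z := by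
    intro z
    funext i
    simp [update_apply, Equiv.eq_symm_apply]
  simp only [h]
  exact hg (σ.symm k) _ (fun i => hv (σ i)) x y hx hy

omit [IsOrderedAddMonoid E] in
theorem AdditiveIn.smul_update {ι : Type*} [DecidableEq ι] [IsOrderedModule ℝ E]
    {g : (ι → E) → F} (hg : ∀ k, AdditiveIn k g) {c : ℝ} (hc : 0 ≤ c) (d : ℝ) (j k : ι) :
    AdditiveIn k fun v => d • g (update v j (c • v j)) := by
  intro v hv x y hx hy
  rcases eq_or_ne k j with rfl | hk
  · simp only [update_self, update_idem, smul_add,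
      hg k v hv _ _ (smul_nonneg hc hx) (smul_nonneg hc hy)]
  · simp only [update_of_ne hk.symm, update_comm hk, ← smul_add,
      hg k _ (update_nonneg hv j (smul_nonneg hc (hv j))) x y hx hy]

end Modulus

/-! ### Absolute values of multilinear maps and polynomials -/

section LatticeModulus

open Function

variable {n : ℕ} {E F : Type*} [AddCommGroup E] [Module ℝ E] [Lattice E] [IsOrderedAddMonoid E]
  [IsOrderedModule ℝ E]
  [AddCommGroup F] [Module ℝ F] [Lattice F] [IsOrderedAddMonoid F] [IsOrderedModule ℝ F]

omit [IsOrderedAddMonoid E] [IsOrderedModule ℝ E] [Lattice F] [IsOrderedAddMonoid F]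
  [IsOrderedModule ℝ F] in
theorem MultilinearMap.additiveIn {ι : Type*} [DecidableEq ι]
    (T : MultilinearMap ℝ (fun _ : ι => E) F) (k : ι) : AdditiveIn k T :=
  fun v _ x y _ _ => T.map_update_add v k x y

omit [IsOrderedAddMonoid E] [IsOrderedModule ℝ E] [IsOrderedModule ℝ F] in
theorem MultilinearMap.multiSubadditive_abs {ι : Type*} [DecidableEq ι]
    (T : MultilinearMap ℝ (fun _ : ι => E) F) : MultiSubadditive fun v => |T v| :=
  fun k v _ => ⟨by simp, fun x y _ _ => by
    simpa only [T.map_update_add] using abs_add_le _ _⟩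

/-- The modulus of a multilinear map: the least positive multilinear map above `T` and `-T`. -/
theorem MultilinearMap.exists_modulus {ι : Type*} [Finite ι] (hF : IsDedekindComplete F)
    {T S : MultilinearMap ℝ (fun _ : ι => E) F} (hTS : ∀ v, 0 ≤ v → |T v| ≤ S v) :
    ∃ M : MultilinearMap ℝ (fun _ : ι => E) F, (∀ v, 0 ≤ v → |T v| ≤ M v) ∧
      ∀ R : (ι → E) → F, (∀ [DecidableEq ι] (k : ι), AdditiveIn k R) →
        (∀ v, 0 ≤ v → |T v| ≤ R v) → ∀ v, 0 ≤ v → M v ≤ R v := by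
  classical
  obtain ⟨g, hadd, hTg, hmin⟩ :=
    exists_least_additive hF S.additiveIn hTS T.multiSubadditive_abs
  -- Homogeneity comes from minimality: rescaling variable `k` by `c` and the value by `c⁻¹` gives
  -- another additive majorant of `|T|`. The reverse inequality is the same one for `c⁻¹`.
  have hle : ∀ (k : ι) (c : ℝ), 0 < c → ∀ v, 0 ≤ v → c • g v ≤ g (update v k (c • v k)) := by
    intro k c hc v hv
    have h := hmin (fun v => c⁻¹ • g (update v k (c • v k)))
      (AdditiveIn.smul_update hadd hc.le c⁻¹ k) (fun v hv => ?_) v hv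
    · have h' := smul_le_smul_of_nonneg_left h hc.le
      rwa [smul_smul, mul_inv_cancel₀ hc.ne', one_smul] at h'
    · have h1 := hTg _ (update_nonneg hv k (smul_nonneg hc.le (hv k)))
      rw [T.map_update_smul, update_eq_self, abs_le', ← smul_neg] at h1
      exact abs_le'.mpr ⟨(le_inv_smul_iff_of_pos hc).mpr h1.1, (le_inv_smul_iff_of_pos hc).mpr h1.2⟩
  have hsmul : ∀ (k : ι) (c : ℝ), 0 < c → ∀ v, 0 ≤ v → g (update v k (c • v k)) = c • g v := by
    intro k c hc v hv
    refine le_antisymm ?_ (hle k c hc v hv)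
    have h := hle k c⁻¹ (inv_pos.mpr hc) _ (update_nonneg hv k (smul_nonneg hc.le (hv k)))
    rw [update_self, update_idem, smul_smul, inv_mul_cancel₀ hc.ne', one_smul,
      update_eq_self] at h
    have h' := smul_le_smul_of_nonneg_left h hc.le
    rwa [smul_smul, mul_inv_cancel₀ hc.ne', one_smul] at h'
  have hg : PartlyLinear ∅ g := by
    -- `PartlyLinear` leaves the entry of `v` at `k` free, whereas `AdditiveIn` wants all of `v`
    -- nonnegative; the free entry is overwritten.
    have hfix : ∀ (v : ι → E) (k : ι) (z : E), (∀ i, i ≠ k → i ∉ (∅ : Finset ι) → 0 ≤ v i) →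
        0 ≤ z → 0 ≤ update v k z := by
      intro v k z hv hz i
      rcases eq_or_ne i k with rfl | hi
      · simpa using hz
      · simpa [hi] using hv i hi (by simp)
    constructor
    · intro v k x y hv hxy
      obtain ⟨hx, hy⟩ := hxy (by simp)
      simpa using hadd k _ (hfix v k 0 hv le_rfl) x y hx hy
    · intro v k c x hv hcx
      obtain ⟨hc, hx⟩ := hcx (by simp)
      rcases hc.eq_or_lt with rfl | hc
      · simpa using (hadd k _ (hfix v k 0 hv le_rfl)).map_zero
      · simpa using hsmul k c hc _ (hfix v k x hv hx)
  obtain ⟨M, hM⟩ := hg.exists_multilinearMap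
  refine ⟨M, fun v hv => (hTg v hv).trans_eq (hM v hv).symm, fun R hR hTR v hv => ?_⟩
  rw [hM v hv]
  exact hmin R hR hTR v hv

-- Permuting the variables of `M` gives another additive majorant of `|T|`, so `M` lies below each
-- of its permutations; the inverse permutation turns this into equality on the cone, which
-- determines `M`.
omit [IsOrderedModule ℝ E] [IsOrderedAddMonoid F] [IsOrderedModule ℝ F] in
theorem MultilinearMap.modulus_symmetric {ι : Type*} [Finite ι]
    {T M : MultilinearMap ℝ (fun _ : ι => E) F} (hTM : ∀ v, 0 ≤ v → |T v| ≤ M v)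
    (hmin : ∀ R : (ι → E) → F, (∀ [DecidableEq ι] (k : ι), AdditiveIn k R) →
        (∀ v, 0 ≤ v → |T v| ≤ R v) → ∀ v, 0 ≤ v → M v ≤ R v)
    (hT : ∀ (σ : Equiv.Perm ι) v, T (fun i => v (σ i)) = T v) (σ : Equiv.Perm ι) (v : ι → E) :
    M (fun i => v (σ i)) = M v := by
  have hle : ∀ (σ : Equiv.Perm ι) v, 0 ≤ v → M v ≤ M fun i => v (σ i) := by
    intro σ v hv
    refine hmin (fun v => M fun i => v (σ i)) (AdditiveIn.comp_perm M.additiveIn σ)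
      (fun w hw => ?_) v hv
    rw [← hT σ w]
    exact hTM _ fun i => hw (σ i)
  have h : M.domDomCongr σ = M := by
    refine MultilinearMap.ext_of_nonneg fun w hw => ?_
    rw [MultilinearMap.domDomCongr_apply]
    refine le_antisymm ?_ (hle σ w hw)
    have := hle σ.symm (fun i => w (σ i)) fun i => hw (σ i)
    simpa using this
  exact congrArg (fun S : MultilinearMap ℝ (fun _ : ι => E) F => S v) h

namespace HomPoly

omit [IsOrderedModule ℝ E] [IsOrderedModule ℝ F] in
theorem le_iff_isPositive {P Q : HomPoly n E F} : P ≤ Q ↔ IsPositive (Q - P) := Iff.rfl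

omit [IsOrderedModule ℝ E] [IsOrderedModule ℝ F] in
theorem nonneg_iff_isPositive {P : HomPoly n E F} : 0 ≤ P ↔ IsPositive P := by
  rw [le_iff_isPositive, sub_zero]

omit [IsOrderedModule ℝ E] [IsOrderedModule ℝ F] in
instance isOrderedAddMonoid_homPoly : IsOrderedAddMonoid (HomPoly n E F) where
  add_le_add_left P Q h R := by
    rw [le_iff_isPositive] at h ⊢
    rwa [add_sub_add_right_eq_sub]

omit [IsOrderedModule ℝ E] in
instance isOrderedModule_homPoly : IsOrderedModule ℝ (HomPoly n E F) :=
  .of_smul_nonneg fun _ hc _ hP =>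
    nonneg_iff_isPositive.mpr ((nonneg_iff_isPositive.mp hP).smul hc)

omit [IsOrderedModule ℝ E] [IsOrderedModule ℝ F] in
theorem le_iff_toMultilinear {P Q : HomPoly n E F} :
    P ≤ Q ↔ ∀ v, 0 ≤ v → P.toMultilinear v ≤ Q.toMultilinear v := by
  rw [le_iff_isPositive, isPositive_iff_toMultilinear, toMultilinear_sub]
  refine forall₂_congr fun v _ => ?_
  rw [_root_.sub_apply, sub_nonneg]

/-- Regular polynomials have an absolute value. -/
theorem exists_least_ge_neg (hF : IsDedekindComplete F) {P Q : HomPoly n E F} (h₁ : P ≤ Q)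
    (h₂ : -P ≤ Q) : ∃ M : HomPoly n E F, P ≤ M ∧ -P ≤ M ∧ ∀ R, P ≤ R → -P ≤ R → M ≤ R := by
  have habs : ∀ {R : HomPoly n E F}, (P ≤ R ∧ -P ≤ R) ↔
      ∀ v, 0 ≤ v → |P.toMultilinear v| ≤ R.toMultilinear v := by
    intro R
    simp only [le_iff_toMultilinear, ← forall_and, abs_le', toMultilinear_neg,
      _root_.neg_apply]
  obtain ⟨M, hM, hmin⟩ := MultilinearMap.exists_modulus hF (habs.mp ⟨h₁, h₂⟩)
  have hsymm := MultilinearMap.modulus_symmetric hM hmin P.isAssociated_toMultilinear.1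
  have hass : IsAssociated M fun x => M fun _ => x := ⟨hsymm, fun _ => rfl⟩
  let M' : HomPoly n E F := ⟨fun x => M fun _ => x, M, hass⟩
  have hM' : M'.toMultilinear = M := M'.isAssociated_toMultilinear.unique hass
  have h := habs (R := M').mpr (by rwa [hM'])
  refine ⟨M', h.1, h.2, fun R hR₁ hR₂ => ?_⟩
  rw [le_iff_toMultilinear, hM']
  exact hmin _ R.toMultilinear.additiveIn (habs.mp ⟨hR₁, hR₂⟩)

end HomPoly

end LatticeModulus

/-! ### The dominated norm on an ordered Banach space -/

section DominatedNorm

variable {V W : Type*} [NormedAddCommGroup V] [PartialOrder V]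

/-- The infimum of the norms of the positive `q` with `±v ≤ q`. -/
def dominatedNorm (v : V) : ℝ := sInf {r | ∃ q : V, 0 ≤ q ∧ v ≤ q ∧ -v ≤ q ∧ r = ‖q‖}

theorem dominatedNorm_nonneg (v : V) : 0 ≤ dominatedNorm v :=
  Real.sInf_nonneg (by rintro _ ⟨q, -, -, -, rfl⟩; exact norm_nonneg q)

theorem dominatedNorm_le {v q : V} (h0 : 0 ≤ q) (h1 : v ≤ q) (h2 : -v ≤ q) :
    dominatedNorm v ≤ ‖q‖ :=
  csInf_le ⟨0, by rintro _ ⟨q, -, -, -, rfl⟩; exact norm_nonneg q⟩ ⟨q, h0, h1, h2, rfl⟩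

theorem exists_norm_lt_of_dominatedNorm_lt {v : V} (hv : ∃ q : V, 0 ≤ q ∧ v ≤ q ∧ -v ≤ q) {r : ℝ}
    (hr : dominatedNorm v < r) : ∃ q : V, 0 ≤ q ∧ v ≤ q ∧ -v ≤ q ∧ ‖q‖ < r := by
  obtain ⟨q, h0, h1, h2⟩ := hv
  obtain ⟨_, ⟨q, h0, h1, h2, rfl⟩, h⟩ := exists_lt_of_csInf_lt (by exact ⟨_, q, h0, h1, h2, rfl⟩) hr
  exact ⟨q, h0, h1, h2, h⟩

theorem le_dominatedNorm {v : V} (hv : ∃ q : V, 0 ≤ q ∧ v ≤ q ∧ -v ≤ q) {r : ℝ}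
    (hr : ∀ q : V, 0 ≤ q → v ≤ q → -v ≤ q → r ≤ ‖q‖) : r ≤ dominatedNorm v := by
  refine le_of_forall_gt fun s hs => ?_
  obtain ⟨q, h0, h1, h2, h⟩ := exists_norm_lt_of_dominatedNorm_lt hv hs
  exact (hr q h0 h1 h2).trans_lt h

theorem dominatedNorm_neg (v : V) : dominatedNorm (-v) = dominatedNorm v := by
  simp only [dominatedNorm, neg_neg]
  congr 1
  ext r
  exact exists_congr fun q => and_congr_right fun _ => by rw [and_left_comm]

variable [IsOrderedAddMonoid V]

theorem dominatedNorm_add_le {v w : V} (hv : ∃ q : V, 0 ≤ q ∧ v ≤ q ∧ -v ≤ q)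
    (hw : ∃ q : V, 0 ≤ q ∧ w ≤ q ∧ -w ≤ q) :
    dominatedNorm (v + w) ≤ dominatedNorm v + dominatedNorm w := by
  refine le_of_forall_pos_le_add fun ε hε => ?_
  obtain ⟨p, p0, p1, p2, hp⟩ := exists_norm_lt_of_dominatedNorm_lt hv
    (lt_add_of_pos_right _ (half_pos hε))
  obtain ⟨q, q0, q1, q2, hq⟩ := exists_norm_lt_of_dominatedNorm_lt hw
    (lt_add_of_pos_right _ (half_pos hε))
  have h := dominatedNorm_le (add_nonneg p0 q0) (add_le_add p1 q1)
    (by rw [neg_add]; exact add_le_add p2 q2)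
  linarith [norm_add_le p q]

theorem exists_bound_of_sub {a b : V} (ha : 0 ≤ a) (hb : 0 ≤ b) :
    0 ≤ a + b ∧ a - b ≤ a + b ∧ -(a - b) ≤ a + b := by
  refine ⟨add_nonneg ha hb, ?_, ?_⟩
  · rw [sub_eq_add_neg]
    gcongr
    exact (neg_nonpos.mpr hb).trans hb
  · rw [neg_sub, sub_eq_add_neg, add_comm a b]
    gcongr
    exact (neg_nonpos.mpr ha).trans ha

/-- `Q m` is the tail `∑ q (m + k)`. It dominates `±(x (m + M) - x m)` by telescoping, and the
closed order lets `M` tend to infinity. The bound on its norm is the geometric tail. -/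
theorem exists_dominated_limit [CompleteSpace V] [OrderClosedTopology V] {x q : ℕ → V}
    (hq : ∀ k, ‖q k‖ ≤ (1 / 2) ^ k) (h0 : ∀ k, 0 ≤ q k)
    (h1 : ∀ k, x (k + 1) - x k ≤ q k) (h2 : ∀ k, -(x (k + 1) - x k) ≤ q k)
    (hx : ∀ k, ‖x (k + 1) - x k‖ ≤ ‖q k‖) :
    ∃ (p : V) (Q : ℕ → V), ∀ m, 0 ≤ Q m ∧ p - x m ≤ Q m ∧ -(p - x m) ≤ Q m ∧
      ‖Q m‖ ≤ (1 / 2) ^ m * 2 := by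
  have hcau : CauchySeq x := by
    refine cauchySeq_of_le_geometric (1 / 2) 1 (by norm_num) fun k => ?_
    rw [dist_comm, dist_eq_norm, one_mul]
    exact (hx k).trans (hq k)
  obtain ⟨p, hp⟩ := cauchySeq_tendsto_of_complete hcau
  have hb : ∀ m k, ‖q (m + k)‖ ≤ (1 / 2) ^ m * (1 / 2) ^ k := fun m k => by
    rw [← pow_add]
    exact hq _
  have hg : ∀ m : ℕ, HasSum (fun k : ℕ => (1 / 2 : ℝ) ^ m * (1 / 2) ^ k) ((1 / 2) ^ m * 2) :=
    fun m => hasSum_geometric_two.mul_left _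
  have hs : ∀ m, HasSum (fun k => q (m + k)) (∑' k, q (m + k)) := fun m =>
    (Summable.of_norm_bounded (hg m).summable (hb m)).hasSum
  have hpm : ∀ m, Tendsto (fun M => x (m + M) - x m) atTop (𝓝 (p - x m)) := fun m =>
    ((tendsto_add_atTop_iff_nat m).mpr hp |>.congr fun M => by rw [add_comm]).sub_const _
  refine ⟨p, fun m => ∑' k, q (m + k), fun m => ⟨tsum_nonneg fun k => h0 _, ?_, ?_,
    tsum_of_norm_bounded (hg m) (hb m)⟩⟩
  · refine le_of_tendsto_of_tendsto' (hpm m) (hs m).tendsto_sum_nat fun M => ?_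
    induction M with
    | zero => simp
    | succ M ih =>
      rw [Finset.sum_range_succ, ← sub_add_sub_cancel' (x (m + M))]
      rw [add_comm]
      simpa [add_comm, add_assoc, add_sub] using add_le_add ih (h1 (m + M))
  · refine le_of_tendsto_of_tendsto' (hpm m).neg (hs m).tendsto_sum_nat fun M => ?_
    induction M with
    | zero => simp
    | succ M ih =>
      rw [Finset.sum_range_succ]
      refine le_of_eq_of_le ?_ (add_le_add ih (h2 (m + M)))
      rw [← add_assoc]
      abel

variable [NormedSpace ℝ V] [IsOrderedModule ℝ V]

omit [IsOrderedAddMonoid V] in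
theorem dominatedNorm_smul_le {v : V} (hv : ∃ q : V, 0 ≤ q ∧ v ≤ q ∧ -v ≤ q) {c : ℝ}
    (hc : 0 < c) : dominatedNorm (c • v) ≤ c * dominatedNorm v := by
  rw [← div_le_iff₀' hc]
  refine le_dominatedNorm hv fun q q0 q1 q2 => ?_
  rw [div_le_iff₀' hc]
  have h := dominatedNorm_le (smul_nonneg hc.le q0) (smul_le_smul_of_nonneg_left q1 hc.le)
    (by rw [← smul_neg]; exact smul_le_smul_of_nonneg_left q2 hc.le)
  rwa [norm_smul, Real.norm_of_nonneg hc.le] at h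

omit [IsOrderedAddMonoid V] in
theorem dominatedNorm_smul {v : V} (hv : ∃ q : V, 0 ≤ q ∧ v ≤ q ∧ -v ≤ q) (c : ℝ) :
    dominatedNorm (c • v) = |c| * dominatedNorm v := by
  have hpos : ∀ {c : ℝ}, 0 < c → dominatedNorm (c • v) = c * dominatedNorm v := by
    intro c hc
    refine le_antisymm (dominatedNorm_smul_le hv hc) ?_
    obtain ⟨q, q0, q1, q2⟩ := hv
    have h := dominatedNorm_smul_le (v := c • v) ⟨c • q, smul_nonneg hc.le q0,
      smul_le_smul_of_nonneg_left q1 hc.le,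
      by rw [← smul_neg]; exact smul_le_smul_of_nonneg_left q2 hc.le⟩ (inv_pos.mpr hc)
    rwa [smul_smul, inv_mul_cancel₀ hc.ne', one_smul, le_inv_mul_iff₀ hc] at h
  rcases lt_trichotomy c 0 with hc | rfl | hc
  · rw [abs_of_neg hc, ← hpos (neg_pos.mpr hc), neg_smul, dominatedNorm_neg]
  · have h : dominatedNorm (0 : V) ≤ ‖(0 : V)‖ := dominatedNorm_le le_rfl le_rfl (by simp)
    rw [norm_zero] at h
    simpa using h.antisymm (dominatedNorm_nonneg _)
  · rw [abs_of_pos hc, hpos hc]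

variable [CompleteSpace V] [OrderClosedTopology V] [AddCommGroup W] [Module ℝ W]

/-- If the norm of `V` is monotone in the sense that `±v ≤ q` implies `‖v‖ ≤ ‖q‖`, then the
dominated norm is a complete norm on the span of the positive cone. -/
theorem isCompleteNorm_dominatedNorm (hmono : ∀ v q : V, v ≤ q → -v ≤ q → ‖v‖ ≤ ‖q‖)
    (j : W →ₗ[ℝ] V) (hj : Function.Injective j)
    (hrange : ∀ v, (∃ w, j w = v) ↔ ∃ a b : V, 0 ≤ a ∧ 0 ≤ b ∧ v = a - b) :
    IsCompleteNorm fun w => dominatedNorm (j w) := by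
  have hdom : ∀ w, ∃ q : V, 0 ≤ q ∧ j w ≤ q ∧ -j w ≤ q := by
    intro w
    obtain ⟨a, b, ha, hb, h⟩ := (hrange (j w)).mp ⟨w, rfl⟩
    rw [h]
    exact ⟨a + b, exists_bound_of_sub ha hb⟩
  have hadd : ∀ v w, dominatedNorm (j (v + w)) ≤ dominatedNorm (j v) + dominatedNorm (j w) := by
    intro v w
    rw [map_add]
    exact dominatedNorm_add_le (hdom v) (hdom w)
  refine ⟨fun w => dominatedNorm_nonneg _, fun w hw => ?_, fun c w => ?_, hadd, fun u hu => ?_⟩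
  · have h : ‖j w‖ ≤ dominatedNorm (j w) :=
      le_dominatedNorm (hdom w) fun q _ q1 q2 => hmono _ q q1 q2
    have h' : j w = 0 := norm_eq_zero.mp ((h.trans_eq hw).antisymm (norm_nonneg _))
    exact hj (h'.trans j.map_zero.symm)
  · rw [map_smul]
    exact dominatedNorm_smul (hdom w) c
  · choose K hK using fun k : ℕ => hu ((1 / 2) ^ k) (by positivity)
    -- Summing the thresholds makes the chosen indices monotone while keeping `φ k` above `K k`.
    let φ : ℕ → ℕ := fun k => ∑ i ∈ Finset.range (k + 1), K i
    have hφK : ∀ k, K k ≤ φ k := fun k =>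
      Finset.single_le_sum (f := K) (fun _ _ => Nat.zero_le _) (Finset.self_mem_range_succ k)
    have hφ : ∀ k, φ k ≤ φ (k + 1) := fun k => by
      simp only [φ, Finset.sum_range_succ _ (k + 1)]
      exact Nat.le_add_right _ _
    choose q q0 q1 q2 hq using fun k => exists_norm_lt_of_dominatedNorm_lt
      (hdom (u (φ (k + 1)) - u (φ k))) (hK k _ ((hφK k).trans (hφ k)) _ (hφK k))
    simp only [map_sub] at q1 q2
    obtain ⟨p, Q, hQ⟩ := exists_dominated_limit (x := fun k => j (u (φ k))) (fun k => (hq k).le) q0 q1 q2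
      fun k => hmono _ _ (q1 k) (q2 k)
    obtain ⟨Q0, Q1, -, -⟩ := hQ 0
    -- The limit `p` is only known to lie in `V`. Since `Q 0` dominates `p - j (u (φ 0))`, that
    -- vector is a difference of two positive ones and so comes from `W`.
    obtain ⟨w, hw⟩ := (hrange (p - j (u (φ 0)))).mpr
      ⟨Q 0, Q 0 - (p - j (u (φ 0))), Q0, sub_nonneg.mpr Q1, by abel⟩
    have hp : j (u (φ 0) + w) = p := by rw [map_add, hw]; abel
    refine ⟨u (φ 0) + w, ?_⟩
    have hm : ∀ m, dominatedNorm (j (u (φ m) - (u (φ 0) + w))) ≤ (1 / 2) ^ m * 2 := by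
      intro m
      obtain ⟨Q0, Q1, Q2, Q3⟩ := hQ m
      rw [map_sub, hp]
      refine (dominatedNorm_le Q0 ?_ ?_).trans Q3
      · rwa [neg_sub] at Q2
      · rwa [neg_sub]
    rw [Metric.tendsto_atTop]
    intro ε hε
    -- One third pays for the distance from `u i` to `u (φ m)`, two thirds for the tail bound `(1 /
    -- 2) ^ m * 2`.
    obtain ⟨m, hmε⟩ := exists_pow_lt_of_lt_one (show 0 < ε / 3 by positivity)
      (show (1 / 2 : ℝ) < 1 by norm_num)
    refine ⟨K m, fun i hi => ?_⟩
    rw [Real.dist_0_eq_abs, abs_of_nonneg (dominatedNorm_nonneg _),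
      ← sub_add_sub_cancel (u i) (u (φ m))]
    have h1 := hK m i hi _ (hφK m)
    have h2 := hm m
    have h3 := hadd (u i - u (φ m)) (u (φ m) - (u (φ 0) + w))
    linarith

end DominatedNorm

/-! ### Normed structures from a complete norm -/

section CompleteNorm

variable {V : Type*} [AddCommGroup V] [Module ℝ V] {N : V → ℝ}

theorem IsCompleteNorm.neg (hN : IsCompleteNorm N) (v : V) : N (-v) = N v := by
  simpa using hN.smul (-1) v

/-- The normed group structure given by a norm. -/
abbrev IsCompleteNorm.normedAddCommGroup (hN : IsCompleteNorm N) : NormedAddCommGroup V :=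
  AddGroupNorm.toNormedAddCommGroup
    { toFun := N
      map_zero' := by simpa using hN.smul 0 0
      add_le' := hN.add_le
      neg' := hN.neg
      eq_zero_of_map_eq_zero' := hN.eq_zero }

/-- The normed space structure given by a norm. -/
abbrev IsCompleteNorm.normedSpace (hN : IsCompleteNorm N) :
    letI := hN.normedAddCommGroup
    NormedSpace ℝ V :=
  letI := hN.normedAddCommGroup
  { norm_smul_le := fun c v => (hN.smul c v).le }

theorem IsCompleteNorm.completeSpace (hN : IsCompleteNorm N) :
    letI := hN.normedAddCommGroup
    CompleteSpace V := by
  let := hN.normedAddCommGroup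
  have hdist : ∀ v w : V, dist v w = N (v - w) := fun v w => dist_eq_norm v w
  refine Metric.complete_of_cauchySeq_tendsto fun u hu => ?_
  obtain ⟨v, hv⟩ := hN.complete u fun ε hε => by
    simpa only [hdist] using Metric.cauchySeq_iff.mp hu ε hε
  exact ⟨v, tendsto_iff_dist_tendsto_zero.mpr (by simpa only [hdist] using hv)⟩

end CompleteNorm

/-! ### Vector lattices from absolute values -/

section VectorLattice

instance Submodule.isOrderedModule_coe {V : Type*} [AddCommGroup V] [Module ℝ V] [PartialOrder V]
    [IsOrderedAddMonoid V] [IsOrderedModule ℝ V] (S : Submodule ℝ V) : IsOrderedModule ℝ S :=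
  .of_smul_nonneg fun c hc a ha => (smul_nonneg hc (show 0 ≤ (a : V) from ha) : 0 ≤ c • (a : V))

variable {V : Type*} [AddCommGroup V] [Module ℝ V] [PartialOrder V] [IsOrderedAddMonoid V]
  [IsOrderedModule ℝ V]

omit [Module ℝ V] [IsOrderedAddMonoid V] [IsOrderedModule ℝ V] in
theorem isModulus_iff {a m : V} :
    IsModulus a m ↔ (a ≤ m ∧ -a ≤ m) ∧ ∀ b, a ≤ b → -a ≤ b → m ≤ b := by
  simp only [IsModulus, IsLUB, IsLeast, mem_upperBounds, mem_lowerBounds, Set.mem_insert_iff,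
    Set.mem_singleton_iff, forall_eq_or_imp, forall_eq, and_imp]

/-- An ordered vector space in which absolute values exist is a vector lattice. -/
theorem isVectorLattice_of_exists_isModulus (h : ∀ a : V, ∃ m, IsModulus a m) :
    IsVectorLattice V := by
  refine ⟨fun a b c hab => by gcongr, fun r a hr ha => smul_nonneg hr ha, fun a b => ?_⟩
  obtain ⟨m, hm⟩ := h (a - b)
  obtain ⟨⟨h1, h2⟩, h3⟩ := isModulus_iff.mp hm
  have htwo : (0 : ℝ) < 2⁻¹ := by norm_num
  -- The supremum is `(a + b + |a - b|) / 2`.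
  refine ⟨(2⁻¹ : ℝ) • (a + b + m), ?_, fun d hd => ?_⟩
  · rintro c (rfl | rfl)
    · rw [le_inv_smul_iff_of_pos two_pos, two_smul]
      calc c + c = c + b + (c - b) := by abel
        _ ≤ _ := by gcongr
    · rw [le_inv_smul_iff_of_pos two_pos, two_smul]
      calc c + c = a + c + -(a - c) := by abel
        _ ≤ _ := by gcongr
  · have ha : a ≤ d := hd (by simp)
    have hb : b ≤ d := hd (by simp)
    rw [inv_smul_le_iff_of_pos two_pos, two_smul, ← le_sub_iff_add_le']
    apply h3
    · calc a - b = a + a - (a + b) := by abel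
        _ ≤ _ := by gcongr
    · calc -(a - b) = b + b - (a + b) := by abel
        _ ≤ _ := by gcongr

end VectorLattice

namespace HomPoly

/-! ### Order structure of regular polynomials and of `𝒜ʳ` -/

section Algebraic

variable {n : ℕ} {E F : Type*} [AddCommGroup E] [Module ℝ E] [Lattice E] [IsOrderedAddMonoid E]
  [AddCommGroup F] [Module ℝ F] [Lattice F] [IsOrderedAddMonoid F] [IsOrderedModule ℝ F]

-- Expand `P (x⁺ - x⁻)` and `Q (x⁺ + x⁻)` over the same subsets: the terms of `P` carry a sign `±1`,
-- so `±P ≤ Q` compares them one by one. This makes (II) applicable.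
omit [IsOrderedModule ℝ F] in
theorem apply_le_apply_abs {P Q : HomPoly n E F} (h₁ : P ≤ Q) (h₂ : -P ≤ Q) (x : E) :
    P x ≤ Q |x| := by
  rw [apply_eq_toMultilinear, MultilinearMap.eq_sum_posPart_negPart, apply_eq_toMultilinear Q,
    ← posPart_add_negPart x]
  have h3 : (fun _ : Fin n => x⁺ + x⁻) = (fun _ => x⁺) + fun _ => x⁻ := rfl
  rw [h3, MultilinearMap.map_add_univ]
  refine Finset.sum_le_sum fun t _ => ?_
  have hw : 0 ≤ t.piecewise (fun _ : Fin n => x⁺) fun _ => x⁻ :=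
    piecewise_posPart_negPart_nonneg t fun _ => x
  have hsign : (∏ i : Fin n, if i ∈ t then (1 : ℝ) else -1) = 1 ∨
      (∏ i : Fin n, if i ∈ t then (1 : ℝ) else -1) = -1 := by
    refine Finset.prod_induction _ (fun r : ℝ => r = 1 ∨ r = -1) ?_ (Or.inl rfl) ?_
    · rintro a b (rfl | rfl) (rfl | rfl) <;> simp
    · intro i _
      by_cases hi : i ∈ t <;> simp [hi]
  rcases hsign with h | h <;> rw [h]
  · rw [one_smul]
    exact le_iff_toMultilinear.mp h₁ _ hw
  · have h4 := le_iff_toMultilinear.mp h₂ _ hw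
    rw [toMultilinear_neg, _root_.neg_apply] at h4
    rwa [neg_smul, one_smul]

omit [IsOrderedModule ℝ F] in
theorem abs_apply_le {P Q : HomPoly n E F} (h₁ : P ≤ Q) (h₂ : -P ≤ Q) (x : E) :
    |P x| ≤ Q |x| :=
  abs_le'.mpr ⟨apply_le_apply_abs h₁ h₂ x, by
    rw [← neg_apply]
    exact apply_le_apply_abs h₂ (by rwa [neg_neg]) x⟩

theorem mem_posSpan_iff {𝒜 : Submodule ℝ (HomPoly n E F)} {P : HomPoly n E F} :
    P ∈ posSpan 𝒜 ↔ ∃ Q R, (Q ∈ 𝒜 ∧ 0 ≤ Q) ∧ (R ∈ 𝒜 ∧ 0 ≤ R) ∧ P = Q - R := by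
  simp only [nonneg_iff_isPositive]
  constructor
  · intro h
    induction h using Submodule.span_induction with
    | mem P hP => exact ⟨P, 0, hP, ⟨𝒜.zero_mem, isPositive_zero⟩, by simp⟩
    | zero => exact ⟨0, 0, ⟨𝒜.zero_mem, isPositive_zero⟩, ⟨𝒜.zero_mem, isPositive_zero⟩, by simp⟩
    | add P Q _ _ hP hQ =>
      obtain ⟨P₁, P₂, h₁, h₂, rfl⟩ := hP
      obtain ⟨Q₁, Q₂, k₁, k₂, rfl⟩ := hQ
      exact ⟨P₁ + Q₁, P₂ + Q₂, ⟨𝒜.add_mem h₁.1 k₁.1, h₁.2.add k₁.2⟩,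
        ⟨𝒜.add_mem h₂.1 k₂.1, h₂.2.add k₂.2⟩, by abel⟩
    | smul c P _ hP =>
      obtain ⟨P₁, P₂, h₁, h₂, rfl⟩ := hP
      rcases le_total 0 c with hc | hc
      · exact ⟨c • P₁, c • P₂, ⟨𝒜.smul_mem c h₁.1, h₁.2.smul hc⟩,
          ⟨𝒜.smul_mem c h₂.1, h₂.2.smul hc⟩, by rw [smul_sub]⟩
      · have hc' := neg_nonneg.mpr hc
        refine ⟨-c • P₂, -c • P₁, ⟨𝒜.smul_mem _ h₂.1, h₂.2.smul hc'⟩,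
          ⟨𝒜.smul_mem _ h₁.1, h₁.2.smul hc'⟩, ?_⟩
        rw [smul_sub, neg_smul, neg_smul]
        abel
  · rintro ⟨Q, R, hQ, hR, rfl⟩
    exact Submodule.sub_mem _ (Submodule.subset_span hQ) (Submodule.subset_span hR)

theorem mem_regular_iff {P : HomPoly n E F} :
    P ∈ regular n E F ↔ ∃ Q R : HomPoly n E F, 0 ≤ Q ∧ 0 ≤ R ∧ P = Q - R := by
  simp only [nonneg_iff_isPositive]
  rfl

theorem exists_bound_of_mem_regular {P : HomPoly n E F} (hP : P ∈ regular n E F) :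
    ∃ Q, P ≤ Q ∧ -P ≤ Q := by
  obtain ⟨Q, R, hQ, hR, rfl⟩ := mem_regular_iff.mp hP
  exact ⟨Q + R, (sub_le_self _ hR).trans (le_add_of_nonneg_right hR), by
    rw [neg_sub]
    exact (sub_le_self _ hQ).trans (le_add_of_nonneg_left hQ)⟩

/-- A polynomial that dominates a regular polynomial is regular. -/
theorem mem_regular_of_le {P Q : HomPoly n E F} (hP : P ∈ regular n E F) (h : P ≤ Q) :
    Q ∈ regular n E F := by
  have h1 : Q - P ∈ regular n E F :=
    mem_regular_iff.mpr ⟨Q - P, 0, sub_nonneg.mpr h, le_rfl, by simp⟩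
  simpa using Submodule.add_mem _ h1 hP

theorem nonneg_of_le_of_neg_le {P Q : HomPoly n E F} (h₁ : P ≤ Q)
    (h₂ : -P ≤ Q) : 0 ≤ Q := by
  have h : 0 ≤ (2 : ℝ) • Q := by
    rw [two_smul, ← add_neg_cancel P]
    exact add_le_add h₁ h₂
  have h' := smul_nonneg (inv_nonneg.mpr (zero_le_two (α := ℝ))) h
  rwa [smul_smul, inv_mul_cancel₀ two_ne_zero, one_smul] at h'

omit [IsOrderedModule ℝ F] in
theorem mem_posSpan_of_mem {𝒜 : Submodule ℝ (HomPoly n E F)} {P : HomPoly n E F} (hP : P ∈ 𝒜)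
    (h0 : 0 ≤ P) : P ∈ posSpan 𝒜 :=
  Submodule.subset_span ⟨hP, nonneg_iff_isPositive.mp h0⟩

theorem exists_bound_of_mem_posSpan {𝒜 : Submodule ℝ (HomPoly n E F)} {P : HomPoly n E F}
    (hP : P ∈ posSpan 𝒜) : ∃ Q ∈ 𝒜, P ≤ Q ∧ -P ≤ Q := by
  obtain ⟨Q, R, ⟨hQ, hQ0⟩, ⟨hR, hR0⟩, rfl⟩ := mem_posSpan_iff.mp hP
  exact ⟨Q + R, 𝒜.add_mem hQ hR, (sub_le_self _ hR0).trans (le_add_of_nonneg_right hR0), by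
    rw [neg_sub]
    exact (sub_le_self _ hQ0).trans (le_add_of_nonneg_left hQ0)⟩

omit [IsOrderedModule ℝ F] in
theorem DominationProperty.mem {𝒜 : Submodule ℝ (HomPoly n E F)} (h : DominationProperty 𝒜)
    {P Q : HomPoly n E F} (h0 : 0 ≤ P) (hPQ : P ≤ Q) (hQ : Q ∈ 𝒜) : P ∈ 𝒜 :=
  h P Q (nonneg_iff_isPositive.mp h0) (nonneg_iff_isPositive.mp (h0.trans hPQ)) hPQ hQ

/-- Here `0 ≤ Q - P ≤ 2Q`, so `Q - P` is in `𝒜`, and `P = Q - (Q - P)` is a difference of positive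
members. -/
theorem DominationProperty.mem_posSpan {𝒜 : Submodule ℝ (HomPoly n E F)}
    (h : DominationProperty 𝒜) {P Q : HomPoly n E F} (h₁ : P ≤ Q) (h₂ : -P ≤ Q) (hQ : Q ∈ 𝒜) :
    P ∈ posSpan 𝒜 := by
  have hQ0 := nonneg_of_le_of_neg_le h₁ h₂
  have hle : Q - P ≤ Q + Q := by
    rw [sub_eq_add_neg]
    gcongr
  have h3 := mem_posSpan_of_mem (h.mem (sub_nonneg.mpr h₁) hle (𝒜.add_mem hQ hQ))
    (sub_nonneg.mpr h₁)
  simpa using Submodule.sub_mem _ (mem_posSpan_of_mem hQ hQ0) h3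

theorem isLatticeIdeal_posSpan {𝒜 : Submodule ℝ (HomPoly n E F)} (h : DominationProperty 𝒜) :
    IsLatticeIdeal ((posSpan 𝒜).submoduleOf (regular n E F)) := by
  intro P R P' R' hP hP' hR' hle
  obtain ⟨Q, hQ, h₁, h₂⟩ := exists_bound_of_mem_posSpan (show (P : HomPoly n E F) ∈ _ from hP)
  have hPQ := (isModulus_iff.mp hP').2 ⟨Q, mem_regular_of_le P.2 h₁⟩ h₁ h₂
  obtain ⟨⟨hR₁, hR₂⟩, -⟩ := isModulus_iff.mp hR'
  exact h.mem_posSpan (Q := Q) (hR₁.trans (hle.trans hPQ)) (hR₂.trans (hle.trans hPQ)) hQ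

variable [IsOrderedModule ℝ E]

theorem exists_isModulus_regular (hF : IsDedekindComplete F) (P : regular n E F) :
    ∃ M, IsModulus P M := by
  obtain ⟨Q, h₁, h₂⟩ := exists_bound_of_mem_regular P.2
  obtain ⟨M, hM₁, hM₂, hM⟩ := exists_least_ge_neg hF h₁ h₂
  exact ⟨⟨M, mem_regular_of_le P.2 hM₁⟩,
    isModulus_iff.mpr ⟨⟨hM₁, hM₂⟩, fun R hR₁ hR₂ => hM R hR₁ hR₂⟩⟩

/-- Removes the absolute value from both infimum norms. Dedekind completeness is needed for `|P|` to
exist. -/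
theorem modulusLE_iff (hF : IsDedekindComplete F) {P : regular n E F} {Q : HomPoly n E F} :
    ModulusLE P Q ↔ (P : HomPoly n E F) ≤ Q ∧ -(P : HomPoly n E F) ≤ Q := by
  constructor
  · rintro ⟨M, hM, hMQ⟩
    obtain ⟨⟨h₁, h₂⟩, -⟩ := isModulus_iff.mp hM
    exact ⟨le_trans h₁ hMQ, le_trans h₂ hMQ⟩
  · rintro ⟨h₁, h₂⟩
    obtain ⟨M, hM⟩ := exists_isModulus_regular hF P
    exact ⟨M, hM, (isModulus_iff.mp hM).2 ⟨Q, mem_regular_of_le P.2 h₁⟩ h₁ h₂⟩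

theorem isVectorLattice_regular (hF : IsDedekindComplete F) :
    IsVectorLattice (regular n E F) :=
  isVectorLattice_of_exists_isModulus (exists_isModulus_regular hF)

theorem exists_isModulus_posSpan (hF : IsDedekindComplete F)
    {𝒜 : Submodule ℝ (HomPoly n E F)} (h : DominationProperty 𝒜) (P : posSpan 𝒜) :
    ∃ M, IsModulus P M := by
  obtain ⟨Q, hQ, h₁, h₂⟩ := exists_bound_of_mem_posSpan P.2
  obtain ⟨M, hM₁, hM₂, hM⟩ := exists_least_ge_neg hF h₁ h₂
  have hM0 := nonneg_of_le_of_neg_le hM₁ hM₂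
  exact ⟨⟨M, mem_posSpan_of_mem (h.mem hM0 (hM Q h₁ h₂) hQ) hM0⟩,
    isModulus_iff.mpr ⟨⟨hM₁, hM₂⟩, fun R hR₁ hR₂ => hM R hR₁ hR₂⟩⟩

end Algebraic

/-! ### Continuity of evaluations and closedness of the cone -/

section Analytic

variable {n : ℕ} {E F : Type*} [NormedAddCommGroup E] [NormedSpace ℝ E]
  [NormedAddCommGroup F] [NormedSpace ℝ F]

theorem supNorm_nonneg (P : HomPoly n E F) : 0 ≤ supNorm P :=
  Real.sSup_nonneg (by rintro _ ⟨x, -, rfl⟩; exact norm_nonneg _)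

/-- Continuity at `0` bounds `P` on a small ball, and homogeneity rescales. The term `‖P 0‖` is kept
because `P 0` need not vanish when `n = 0`. -/
theorem bddAbove_of_continuous {P : HomPoly n E F} (hP : P ∈ continuousPoly n E F) :
    BddAbove {r | ∃ x : E, ‖x‖ ≤ 1 ∧ r = ‖P x‖} := by
  have hP0 : ContinuousAt P 0 := Continuous.continuousAt hP
  obtain ⟨δ, hδ, h⟩ := Metric.continuousAt_iff.mp hP0 1 one_pos
  refine ⟨(2 / δ) ^ n * (‖P 0‖ + 1), ?_⟩
  rintro _ ⟨x, hx, rfl⟩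
  have hy : dist ((δ / 2) • x) 0 < δ := by
    rw [dist_zero_right, norm_smul, Real.norm_of_nonneg (by positivity)]
    nlinarith
  have h1 : ‖P ((δ / 2) • x)‖ ≤ ‖P 0‖ + 1 := by
    have h2 := h hy
    rw [dist_eq_norm] at h2
    linarith [norm_le_norm_add_norm_sub' (P ((δ / 2) • x)) (P 0)]
  have h2 : x = (2 / δ) • (δ / 2) • x := by
    rw [smul_smul, div_mul_div_comm, mul_comm δ, div_self (by positivity), one_smul]
  conv_lhs => rw [h2, map_smul_eq, norm_smul, norm_pow, Real.norm_of_nonneg (by positivity)]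
  gcongr

/-- Scaling by `‖x‖ + 1` instead of `‖x‖` avoids a case `x = 0`; any constant depending only on `x`
makes evaluation continuous. -/
theorem norm_apply_le {P : HomPoly n E F} (hP : P ∈ continuousPoly n E F) (x : E) :
    ‖P x‖ ≤ (‖x‖ + 1) ^ n * supNorm P := by
  have hc : 0 < ‖x‖ + 1 := by positivity
  have h1 : x = (‖x‖ + 1) • (‖x‖ + 1)⁻¹ • x := by
    rw [smul_smul, mul_inv_cancel₀ hc.ne', one_smul]
  have h2 : ‖(‖x‖ + 1)⁻¹ • x‖ ≤ 1 := by
    rw [norm_smul, norm_inv, Real.norm_of_nonneg hc.le, inv_mul_le_one₀ hc]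
    linarith
  have h3 : ‖P ((‖x‖ + 1)⁻¹ • x)‖ ≤ supNorm P := le_csSup (bddAbove_of_continuous hP) ⟨_, h2, rfl⟩
  calc ‖P x‖ = (‖x‖ + 1) ^ n * ‖P ((‖x‖ + 1)⁻¹ • x)‖ := by
        conv_lhs => rw [h1, map_smul_eq, norm_smul, norm_pow, Real.norm_of_nonneg hc.le]
    _ ≤ _ := by gcongr

variable [Lattice E] [IsOrderedAddMonoid E]
  [Lattice F] [IsOrderedAddMonoid F] [IsOrderedModule ℝ F] [HasSolidNorm F]
  {𝒜 : Submodule ℝ (HomPoly n E F)} {N : 𝒜 → ℝ}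

theorem orderClosedTopology_of_supNorm_le (h𝒜 : 𝒜 ≤ continuousPoly n E F) (hN : IsCompleteNorm N)
    (hI : ∀ P : 𝒜, supNorm (P : HomPoly n E F) ≤ N P) :
    letI := hN.normedAddCommGroup
    OrderClosedTopology 𝒜 := by
  let := hN.normedAddCommGroup
  have hcont : ∀ x : E, Continuous fun P : 𝒜 => (P : HomPoly n E F) x := by
    intro x
    let ev : 𝒜 →+ F :=
      { toFun := fun P => (P : HomPoly n E F) x
        map_zero' := rfl
        map_add' := fun _ _ => rfl }
    exact AddMonoidHomClass.continuous_of_bound ev ((‖x‖ + 1) ^ n) fun P =>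
      (norm_apply_le (h𝒜 P.2) x).trans (mul_le_mul_of_nonneg_left (hI P) (by positivity))
  have hclosed : IsClosed {P : 𝒜 | 0 ≤ P} := by
    have h : {P : 𝒜 | 0 ≤ P} = ⋂ (v : Fin n → E) (_ : ∀ i, 0 ≤ v i),
        {P : 𝒜 | 0 ≤ polarSum (P : HomPoly n E F) v} := by
      ext P
      simp only [Set.mem_iInter, Set.mem_ofPred_eq]
      exact nonneg_iff_isPositive.trans (isPositive_iff_polarSum _)
    rw [h]
    refine isClosed_iInter fun v => isClosed_iInter fun _ => isClosed_le continuous_const ?_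
    exact continuous_finsetSum _ fun t _ => (hcont _).const_smul _
  exact ⟨isClosed_le_of_isClosed_nonneg hclosed⟩

variable [IsOrderedModule ℝ E]

omit [HasSolidNorm F] in
theorem rNorm_eq_dominatedNorm (hF : IsDedekindComplete F) (hN : IsCompleteNorm N) :
    rNorm 𝒜 N = fun P =>
      letI := hN.normedAddCommGroup
      dominatedNorm (Submodule.inclusion (posSpan_le 𝒜) P) := by
  let := hN.normedAddCommGroup
  funext P
  refine congrArg sInf (Set.ext fun r => exists_congr fun Q => ?_)
  rw [modulusLE_iff hF, ← nonneg_iff_isPositive, and_assoc]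
  rfl

end Analytic

end HomPoly

/-! ### The r-norm: completeness, comparison and solidity -/

namespace HomPoly

section Main

variable {n : ℕ} {E F : Type*} [NormedAddCommGroup E] [NormedSpace ℝ E]
  [Lattice E] [IsOrderedAddMonoid E] [IsOrderedModule ℝ E]
  [NormedAddCommGroup F] [NormedSpace ℝ F]
  [Lattice F] [IsOrderedAddMonoid F] [IsOrderedModule ℝ F]
  {𝒜 : Submodule ℝ (HomPoly n E F)} {N : 𝒜 → ℝ}

omit [IsOrderedModule ℝ E] in
theorem norm_le_of_le_of_neg_le
    (hII : ∀ P Q : 𝒜, IsPositive (Q : HomPoly n E F) →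
      (∀ x : E, |(P : HomPoly n E F) x| ≤ (Q : HomPoly n E F) |x|) → N P ≤ N Q)
    {P Q : 𝒜} (h₁ : P ≤ Q) (h₂ : -P ≤ Q) : N P ≤ N Q :=
  hII P Q (nonneg_iff_isPositive.mp (nonneg_of_le_of_neg_le (P := (P : HomPoly n E F)) h₁ h₂))
    (abs_apply_le h₁ h₂)

theorem isCompleteNorm_rNorm [HasSolidNorm F] (hF : IsDedekindComplete F)
    (h𝒜 : 𝒜 ≤ continuousPoly n E F) (hN : IsCompleteNorm N)
    (hI : ∀ P : 𝒜, supNorm (P : HomPoly n E F) ≤ N P)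
    (hII : ∀ P Q : 𝒜, IsPositive (Q : HomPoly n E F) →
      (∀ x : E, |(P : HomPoly n E F) x| ≤ (Q : HomPoly n E F) |x|) → N P ≤ N Q) :
    IsCompleteNorm (rNorm 𝒜 N) := by
  let := hN.normedAddCommGroup
  let := hN.normedSpace
  have := hN.completeSpace
  have := orderClosedTopology_of_supNorm_le h𝒜 hN hI
  rw [rNorm_eq_dominatedNorm hF hN]
  refine isCompleteNorm_dominatedNorm (fun P Q => norm_le_of_le_of_neg_le hII) _
    (Submodule.inclusion_injective (posSpan_le 𝒜)) fun P => ?_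
  constructor
  · rintro ⟨R, rfl⟩
    obtain ⟨Q, S, hQ, hS, h⟩ := mem_posSpan_iff.mp R.2
    exact ⟨⟨Q, hQ.1⟩, ⟨S, hS.1⟩, hQ.2, hS.2, Subtype.ext h⟩
  · rintro ⟨Q, S, hQ, hS, rfl⟩
    exact ⟨⟨Q - S, mem_posSpan_iff.mpr ⟨Q, S, ⟨Q.2, hQ⟩, ⟨S.2, hS⟩, rfl⟩⟩, rfl⟩

theorem rNorm_le (hF : IsDedekindComplete F) (hN : IsCompleteNorm N) {P : posSpan 𝒜} {Q : 𝒜}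
    (h₁ : (P : HomPoly n E F) ≤ Q) (h₂ : -(P : HomPoly n E F) ≤ Q) : rNorm 𝒜 N P ≤ N Q := by
  let := hN.normedAddCommGroup
  rw [rNorm_eq_dominatedNorm hF hN]
  exact dominatedNorm_le (nonneg_of_le_of_neg_le (P := (P : HomPoly n E F)) h₁ h₂) h₁ h₂

theorem le_rNorm (hF : IsDedekindComplete F) (hN : IsCompleteNorm N) {P : posSpan 𝒜} {r : ℝ}
    (h : ∀ Q : 𝒜, (P : HomPoly n E F) ≤ Q → -(P : HomPoly n E F) ≤ Q → r ≤ N Q) :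
    r ≤ rNorm 𝒜 N P := by
  let := hN.normedAddCommGroup
  rw [rNorm_eq_dominatedNorm hF hN]
  obtain ⟨Q, hQ, h₁, h₂⟩ := exists_bound_of_mem_posSpan P.2
  exact le_dominatedNorm ⟨⟨Q, hQ⟩, nonneg_of_le_of_neg_le h₁ h₂, h₁, h₂⟩
    fun Q _ hQ₁ hQ₂ => h Q hQ₁ hQ₂

theorem regNorm_le_rNorm (hF : IsDedekindComplete F) (hN : IsCompleteNorm N)
    (hI : ∀ P : 𝒜, supNorm (P : HomPoly n E F) ≤ N P) (P : posSpan 𝒜) :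
    regNorm (Submodule.inclusion (posSpan_le_regular 𝒜) P) ≤ rNorm 𝒜 N P := by
  refine le_rNorm hF hN fun Q h₁ h₂ => le_trans (csInf_le ⟨0, ?_⟩ ?_) (hI Q)
  · rintro _ ⟨Q, -, -, rfl⟩
    exact supNorm_nonneg Q
  · exact ⟨Q, nonneg_iff_isPositive.mp (nonneg_of_le_of_neg_le h₁ h₂),
      (modulusLE_iff hF).mpr ⟨h₁, h₂⟩, rfl⟩

/-- Any `Q` in `𝒜` with `±R ≤ Q` is positive, hence lies in `𝒜ʳ` and is above the modulus `R'`
formed there; so it also dominates `±P`. -/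
theorem rNorm_le_rNorm_of_modulus_le (hF : IsDedekindComplete F) (hN : IsCompleteNorm N)
    {P R P' R' : posSpan 𝒜} (hP : IsModulus P P') (hR : IsModulus R R') (h : P' ≤ R') :
    rNorm 𝒜 N P ≤ rNorm 𝒜 N R := by
  refine le_rNorm hF hN fun Q h₁ h₂ => ?_
  have hRQ : (R' : HomPoly n E F) ≤ Q := (isModulus_iff.mp hR).2
    ⟨Q, mem_posSpan_of_mem Q.2 (nonneg_of_le_of_neg_le h₁ h₂)⟩ h₁ h₂
  obtain ⟨⟨hP₁, hP₂⟩, -⟩ := isModulus_iff.mp hP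
  have hPQ : (P' : HomPoly n E F) ≤ Q := le_trans h hRQ
  exact rNorm_le hF hN (le_trans hP₁ hPQ) (le_trans hP₂ hPQ)

end Main

end HomPoly

end

theorem theorem2p1 (n : ℕ) {E F : Type*}
    -- `E` and `F` are Banach lattices
    [NormedAddCommGroup E] [NormedSpace ℝ E] [CompleteSpace E]
    [Lattice E] [IsOrderedAddMonoid E] [IsOrderedModule ℝ E] [HasSolidNorm E]
    [NormedAddCommGroup F] [NormedSpace ℝ F] [CompleteSpace F]
    [Lattice F] [IsOrderedAddMonoid F] [IsOrderedModule ℝ F] [HasSolidNorm F]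
    (hF : IsDedekindComplete F)
    (𝒜 : Submodule ℝ (HomPoly n E F)) (h𝒜 : 𝒜 ≤ HomPoly.continuousPoly n E F)
    (N : 𝒜 → ℝ) (hN : IsCompleteNorm N)
    (hI : ∀ P : 𝒜, HomPoly.supNorm (P : HomPoly n E F) ≤ N P)
    (hII : ∀ P Q : 𝒜, HomPoly.IsPositive (Q : HomPoly n E F) →
      (∀ x : E, |(P : HomPoly n E F) x| ≤ (Q : HomPoly n E F) |x|) → N P ≤ N Q) :
    IsVectorLattice (HomPoly.regular n E F) ∧
    IsCompleteNorm (HomPoly.rNorm 𝒜 N) ∧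
    (∀ P : HomPoly.posSpan 𝒜,
      HomPoly.regNorm (Submodule.inclusion (HomPoly.posSpan_le_regular 𝒜) P) ≤
        HomPoly.rNorm 𝒜 N P) ∧
    (HomPoly.DominationProperty 𝒜 →
      IsBanachLattice (HomPoly.rNorm 𝒜 N) ∧
      (∀ P : HomPoly.posSpan 𝒜,
        N (Submodule.inclusion (HomPoly.posSpan_le 𝒜) P) ≤ HomPoly.rNorm 𝒜 N P) ∧
      IsLatticeIdeal ((HomPoly.posSpan 𝒜).submoduleOf (HomPoly.regular n E F))) := by
  have hr := HomPoly.isCompleteNorm_rNorm hF h𝒜 hN hI hII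
  refine ⟨HomPoly.isVectorLattice_regular hF, hr, HomPoly.regNorm_le_rNorm hF hN hI, fun hdom => ?_⟩
  refine ⟨⟨isVectorLattice_of_exists_isModulus (HomPoly.exists_isModulus_posSpan hF hdom), hr,
    fun P R P' R' => HomPoly.rNorm_le_rNorm_of_modulus_le hF hN⟩, fun P => ?_,
    HomPoly.isLatticeIdeal_posSpan hdom⟩
  exact HomPoly.le_rNorm hF hN fun Q h₁ h₂ =>
    HomPoly.norm_le_of_le_of_neg_le hII (P := Submodule.inclusion (HomPoly.posSpan_le 𝒜) P) h₁ h₂
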